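/- Let $n\ge 0$ be an integer and $\hbar>0$. Equip $\mathbb R^{2n}=\mathbb R^n_x\times\mathbb R^n_p$, $z=(x,p)$, with the Euclidean norm, Lebesgue measure and the symplectic form $\omega(z,z')=p\cdot x'-x\cdot p'$; let $\mathrm{Sp}(n)$ be its linear symplectic group and $B^{2n}(\sqrt\hbar)$ the closed ball of radius $\sqrt\hbar$ centered at $0$. A quantum blob is a set $S(B^{2n}(\sqrt\hbar))$, $S\in\mathrm{Sp}(n)$. The metaplectic group $\mathrm{Mp}(n)$ is the group of unitary operators on $L^2(\mathbb R^n)$ generated by the operators $$\psi\mapsto e^{\frac{i}{2\hbar}Px\cdot x}\psi(x)\ (P=P^T),\qquad \psi\mapsto i^m\sqrt{|\det L|}\,\psi(Lx)\ (\det L\neq0,\ m\in\mathbb Z,\ m\pi\equiv\arg\det L \bmod 2\pi),$$ $$\psi\mapsto\Big(\tfrac1{2\pi i\hbar}\Big)^{n/2}\int_{\mathbb R^n} e^{-\frac i\hbar x\cdot x'}\psi(x')\,dx',$$ and the covering homomorphism $\mathrm{Mp}(n)\to\mathrm{Sp}(n)$ sends these generators, respectively, to $$\begin{pmatrix}I&0\\P&I\end{pmatrix},\quad\begin{pmatrix}L^{-1}&0\\0&L^T\end{pmatrix},\quad\begin{pmatrix}0&I\\-I&0\end{pmatrix}.$$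 Let $\phi_0(x)=(\pi\hbar)^{-n/4}e^{-|x|^2/2\hbar}$ and, for real $\gamma$, real symmetric $X>0$ and real symmetric $Y$, let $$\psi^\gamma_{X,Y}(x)=i^\gamma(\pi\hbar)^{-n/4}(\det X)^{1/4}e^{-\frac1{2\hbar}(X+iY)x\cdot x}.$$ We say that $\psi\in L^2(\mathbb R^n)$ is a Gaussian pure state corresponding to a set $\Omega\subset\mathbb R^{2n}$ if, for some real positive definite $2n\times 2n$ matrix $\Sigma$, its Wigner transform $$W\psi(x,p)=\Big(\tfrac1{2\pi\hbar}\Big)^n\int_{\mathbb R^n}e^{-\frac i\hbar p\cdot y}\,\psi(x+\tfrac12y)\,\overline{\psi(x-\tfrac12y)}\,dy$$ equals $(2\pi)^{-n}(\det\Sigma)^{-1/2}e^{-\frac12\Sigma^{-1}z\cdot z}$ for all $z=(x,p)$, and $\Omega=\{z:\frac12\Sigma^{-1}z\cdot z\le1\}$. **Theorem.** Let $(\ell,\ell')$ be a Lagrangian frame in $(\mathbb R^{2n},\omega)$, that is, two $n$-dimensional subspaces with $\ell\cap\ell'=0$ on each of which $\omega$ vanishes. Let $X_\ell$ be a (nondegenerate,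 closed) ellipsoid in $\ell$ centered at $0$ and let $$(X_\ell)^\hbar_{\ell'}=\{z'\in\ell':\sup_{z\in X_\ell}\omega(z,z')\le\hbar\},$$ which is an ellipsoid in $\ell'$ centered at $0$. Identify the product $X_\ell\times(X_\ell)^\hbar_{\ell'}$ with the subset $\{z+z': z\in X_\ell,\ z'\in(X_\ell)^\hbar_{\ell'}\}$ of $\mathbb R^{2n}=\ell\oplus\ell'$. (i) Among all ellipsoids of $\mathbb R^{2n}$ contained in $X_\ell\times(X_\ell)^\hbar_{\ell'}$ there is exactly one of maximal volume (the John ellipsoid $\Omega$), and it is a quantum blob: $\Omega=S(B^{2n}(\sqrt\hbar))$ for some $S\in\mathrm{Sp}(n)$. (ii) For every $S\in\mathrm{Sp}(n)$ with $\Omega=S(B^{2n}(\sqrt\hbar))$ there is an $\widehat S\in\mathrm{Mp}(n)$ covering $S$, and for every $\widehat S\in\mathrm{Mp}(n)$ covering $S$ the Gaussian pure states corresponding to $\Omega$ are exactly the functions $\pm i^\mu\widehat S\phi_0$ with $\mu\in\mathbb R$. Moreover, there is exactly one pair $(X,Y)$ of real symmetric $n\times n$ matrices with $X>0$ such that these states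 are exactly the generalized Gaussians $\psi^\gamma_{X,Y}$, $\gamma\in\mathbb R$. -/

import Mathlib

open MeasureTheory

noncomputable section

/-! ### Linear symplectic geometry -/

/-- The phase space `ℝ²ⁿ = ℝⁿ_x × ℝⁿ_p` with its Euclidean norm and Lebesgue measure;
for `z = (x, p)` one has `x i = z (Sum.inl i)` and `p i = z (Sum.inr i)`. -/
abbrev PhaseSpace (n : ℕ) : Type := EuclideanSpace ℝ (Fin n ⊕ Fin n)

/-- The position part `x` of `z = (x, p)`. -/
def posPart {n : ℕ} (z : PhaseSpace n) : EuclideanSpace ℝ (Fin n) :=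
  WithLp.toLp 2 fun i => z (Sum.inl i)

/-- The momentum part `p` of `z = (x, p)`. -/
def momPart {n : ℕ} (z : PhaseSpace n) : EuclideanSpace ℝ (Fin n) :=
  WithLp.toLp 2 fun i => z (Sum.inr i)

/-- The standard symplectic form `ω(z, z') = Jz · z' = p · x' - x · p'`. -/
def sympForm {n : ℕ} (z z' : PhaseSpace n) : ℝ :=
  inner ℝ (momPart z) (posPart z') - inner ℝ (posPart z) (momPart z')

/-- A Lagrangian subspace: dimension `n`, and `ω` vanishes identically on it. -/
def IsLagrangian {n : ℕ} (ℓ : Submodule ℝ (PhaseSpace n)) : Prop :=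
  Module.finrank ℝ ℓ = n ∧ ∀ z ∈ ℓ, ∀ z' ∈ ℓ, sympForm z z' = 0

/-- A Lagrangian frame: a pair of transverse Lagrangian subspaces. -/
def IsLagrangianFrame {n : ℕ} (ℓ ℓ' : Submodule ℝ (PhaseSpace n)) : Prop :=
  IsLagrangian ℓ ∧ IsLagrangian ℓ' ∧ ℓ ⊓ ℓ' = ⊥

/-- A (nondegenerate, closed) ellipsoid centered at `0` and carried by the `n`-dimensional
subspace `ℓ`: the image of the closed unit ball of `ℝⁿ` by a linear map with range `ℓ`. -/
def IsCenteredEllipsoidOn {n : ℕ} (ℓ : Submodule ℝ (PhaseSpace n))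
    (X : Set (PhaseSpace n)) : Prop :=
  ∃ T : EuclideanSpace ℝ (Fin n) →ₗ[ℝ] PhaseSpace n,
    LinearMap.range T = ℓ ∧ X = T '' Metric.closedBall 0 1

/-- The Lagrangian `ħ`-polar dual
`{z' ∈ ℓ' : ω(z, z') ≤ ħ for all z ∈ X}` of a set `X ⊆ ℓ`. -/
def lagrangianPolarDual {n : ℕ} (hbar : ℝ) (ℓ' : Submodule ℝ (PhaseSpace n))
    (X : Set (PhaseSpace n)) : Set (PhaseSpace n) :=
  {z' | z' ∈ ℓ' ∧ ∀ z ∈ X, sympForm z z' ≤ hbar}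

/-- The product `X × X'` of `X ⊆ ℓ` and `X' ⊆ ℓ'`, as a subset of `ℝ²ⁿ = ℓ ⊕ ℓ'`. -/
def frameProduct {n : ℕ} (X X' : Set (PhaseSpace n)) : Set (PhaseSpace n) :=
  {z | ∃ x ∈ X, ∃ x' ∈ X', z = x + x'}

/-- A (closed, full-dimensional, not necessarily centered) ellipsoid of `ℝ²ⁿ`. -/
def IsEllipsoid {n : ℕ} (Ω : Set (PhaseSpace n)) : Prop :=
  ∃ (c : PhaseSpace n) (T : PhaseSpace n ≃ₗ[ℝ] PhaseSpace n),
    Ω = (fun z => c + T z) '' Metric.closedBall 0 1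

/-- `Ω` is an ellipsoid of maximal volume among all ellipsoids contained in `K`. -/
def IsJohnEllipsoid {n : ℕ} (K Ω : Set (PhaseSpace n)) : Prop :=
  IsEllipsoid Ω ∧ Ω ⊆ K ∧
    ∀ Ω' : Set (PhaseSpace n), IsEllipsoid Ω' → Ω' ⊆ K → volume Ω' ≤ volume Ω

/-- The quantum blob `S(B²ⁿ(√ħ))` of `S ∈ Sp(n)`. -/
def quantumBlob {n : ℕ} (hbar : ℝ) (S : Matrix.symplecticGroup (Fin n) ℝ) :
    Set (PhaseSpace n) :=
  Matrix.toEuclideanLin (S : Matrix (Fin n ⊕ Fin n) (Fin n ⊕ Fin n) ℝ) ''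
    Metric.closedBall 0 (Real.sqrt hbar)

/-! ### Gaussian states and the Wigner transform -/

/-- `L²(ℝⁿ)`. -/
abbrev L2Space (n : ℕ) : Type := Lp ℂ 2 (volume : Measure (EuclideanSpace ℝ (Fin n)))

/-- `φ₀(x) = (πħ)^{-n/4} e^{-|x|²/2ħ}`. -/
def standardGaussianFun (n : ℕ) (hbar : ℝ) (x : EuclideanSpace ℝ (Fin n)) : ℂ :=
  (((Real.pi * hbar) ^ (-(n : ℝ) / 4) * Real.exp (-‖x‖ ^ 2 / (2 * hbar)) : ℝ) : ℂ)

theorem memLp_standardGaussianFun (n : ℕ) {hbar : ℝ} (hpos : 0 < hbar) :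
    MemLp (standardGaussianFun n hbar) 2 (volume : Measure (EuclideanSpace ℝ (Fin n))) := by
  have hc : Continuous (standardGaussianFun n hbar) := by
    unfold standardGaussianFun
    fun_prop
  rw [memLp_two_iff_integrable_sq_norm hc.aestronglyMeasurable]
  have hI : Integrable (fun x : EuclideanSpace ℝ (Fin n) =>
      Real.exp (-(1 / hbar) * ‖x‖ ^ 2)) := by
    have h := GaussianFourier.integrable_cexp_neg_mul_sq_norm_add
      (V := EuclideanSpace ℝ (Fin n)) (b := ((1 / hbar : ℝ) : ℂ))
      (by simpa using hpos) 0 0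
    refine h.norm.congr (Filter.Eventually.of_forall fun x => ?_)
    simp only [Complex.norm_exp, zero_mul, add_zero]
    congr 1
    norm_cast
  refine (hI.const_mul (((Real.pi * hbar) ^ (-(n : ℝ) / 4)) ^ 2)).congr
    (Filter.Eventually.of_forall fun x => ?_)
  simp only [standardGaussianFun, Complex.norm_real, Real.norm_eq_abs, sq_abs, mul_pow]
  rw [← Real.exp_nat_mul]
  congr 2
  push_cast
  field_simp

/-- The standard Gaussian `φ₀` as an element of `L²(ℝⁿ)`. -/
def standardGaussian (n : ℕ) (hbar : ℝ) (hpos : 0 < hbar) : L2Space n :=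
  (memLp_standardGaussianFun n hpos).toLp (standardGaussianFun n hbar)

/-- The generalized Gaussian
`ψ^γ_{X,Y}(x) = i^γ (πħ)^{-n/4} (det X)^{1/4} e^{-(X + iY)x·x / 2ħ}`. -/
def generalizedGaussian {n : ℕ} (hbar : ℝ) (X Y : Matrix (Fin n) (Fin n) ℝ) (γ : ℝ)
    (x : EuclideanSpace ℝ (Fin n)) : ℂ :=
  Complex.I ^ (γ : ℂ) *
    (((1 / (Real.pi * hbar)) ^ ((n : ℝ) / 4) * X.det ^ ((1 : ℝ) / 4) : ℝ) : ℂ) *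
    Complex.exp (-(1 / (2 * (hbar : ℂ))) *
      (((inner ℝ (Matrix.toEuclideanLin X x) x : ℝ) : ℂ) +
        Complex.I * ((inner ℝ (Matrix.toEuclideanLin Y x) x : ℝ) : ℂ)))

/-- The Wigner transform
`Wψ(x,p) = (2πħ)^{-n} ∫ e^{-(i/ħ) p·y} ψ(x + y/2) ψ*(x - y/2) dy`. -/
def wignerTransform {n : ℕ} (hbar : ℝ) (ψ : EuclideanSpace ℝ (Fin n) → ℂ)
    (z : PhaseSpace n) : ℂ :=
  (1 / (2 * (Real.pi : ℂ) * (hbar : ℂ))) ^ n *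
    ∫ y : EuclideanSpace ℝ (Fin n),
      Complex.exp (-(Complex.I / (hbar : ℂ)) * ((inner ℝ (momPart z) y : ℝ) : ℂ)) *
        (ψ (posPart z + (1 / 2 : ℝ) • y) *
          (starRingEnd ℂ) (ψ (posPart z - (1 / 2 : ℝ) • y)))

/-- The centered Gaussian distribution on phase space with covariance matrix `Σ`:
`(2π)^{-n} (det Σ)^{-1/2} e^{-Σ⁻¹z·z / 2}`. -/
def gaussianDensity {n : ℕ} (Sig : Matrix (Fin n ⊕ Fin n) (Fin n ⊕ Fin n) ℝ)
    (z : PhaseSpace n) : ℝ :=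
  1 / ((2 * Real.pi) ^ n * Real.sqrt Sig.det) *
    Real.exp (-(1 / 2) * inner ℝ (Matrix.toEuclideanLin Sig⁻¹ z) z)

/-- The covariance ellipsoid `{z : Σ⁻¹z·z / 2 ≤ 1}`. -/
def covarianceEllipsoid {n : ℕ} (Sig : Matrix (Fin n ⊕ Fin n) (Fin n ⊕ Fin n) ℝ) :
    Set (PhaseSpace n) :=
  {z | (1 / 2) * inner ℝ (Matrix.toEuclideanLin Sig⁻¹ z) z ≤ 1}

/-- `ψ ∈ L²(ℝⁿ)` is a (centered) Gaussian pure state corresponding to the set `Ω`: its Wigner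
transform is a centered Gaussian distribution whose covariance ellipsoid is `Ω`. -/
def IsGaussianPureStateOf {n : ℕ} (hbar : ℝ) (ψ : L2Space n) (Ω : Set (PhaseSpace n)) : Prop :=
  ∃ Sig : Matrix (Fin n ⊕ Fin n) (Fin n ⊕ Fin n) ℝ, Sig.PosDef ∧
    (∀ z : PhaseSpace n, wignerTransform hbar (⇑ψ) z = ((gaussianDensity Sig z : ℝ) : ℂ)) ∧
    covarianceEllipsoid Sig = Ω

/-! ### The metaplectic group -/

/-- `U ψ(x) = e^{(i/2ħ) Px·x} ψ(x)` with `P = Pᵀ`, which covers `(x, p) ↦ (x, p + Px)`. -/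
def IsChirpPair {n : ℕ} (hbar : ℝ)
    (U : L2Space n ≃ₗᵢ[ℂ] L2Space n) (S : Matrix.symplecticGroup (Fin n) ℝ) : Prop :=
  ∃ P : Matrix (Fin n) (Fin n) ℝ, P.IsSymm ∧
    (S : Matrix (Fin n ⊕ Fin n) (Fin n ⊕ Fin n) ℝ) = Matrix.fromBlocks 1 0 P 1 ∧
    ∀ ψ : L2Space n, (U ψ : EuclideanSpace ℝ (Fin n) → ℂ) =ᵐ[volume] fun x =>
      Complex.exp (Complex.I / (2 * (hbar : ℂ)) *
        ((inner ℝ (Matrix.toEuclideanLin P x) x : ℝ) : ℂ)) * ψ x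

/-- `U ψ(x) = i^m √|det L| ψ(Lx)` with `det L ≠ 0` and `mπ` a choice of `arg det L`,
which covers `(x, p) ↦ (L⁻¹x, Lᵀp)`. -/
def IsRescalingPair {n : ℕ}
    (U : L2Space n ≃ₗᵢ[ℂ] L2Space n) (S : Matrix.symplecticGroup (Fin n) ℝ) : Prop :=
  ∃ (L : Matrix (Fin n) (Fin n) ℝ) (m : ℤ),
    ((0 < L.det ∧ Even m) ∨ (L.det < 0 ∧ Odd m)) ∧
    (S : Matrix (Fin n ⊕ Fin n) (Fin n ⊕ Fin n) ℝ) =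
      Matrix.fromBlocks L⁻¹ 0 0 L.transpose ∧
    ∀ ψ : L2Space n, (U ψ : EuclideanSpace ℝ (Fin n) → ℂ) =ᵐ[volume] fun x =>
      Complex.I ^ m * ((Real.sqrt |L.det| : ℝ) : ℂ) * ψ (Matrix.toEuclideanLin L x)

/-- `U ψ(x) = (2πiħ)^{-n/2} ∫ e^{-(i/ħ) x·x'} ψ(x') dx'` (as the unitary operator given by this
formula on the dense subspace `L¹ ∩ L²`), which covers `J : (x, p) ↦ (p, -x)`. -/
def IsFourierPair {n : ℕ} (hbar : ℝ)
    (U : L2Space n ≃ₗᵢ[ℂ] L2Space n) (S : Matrix.symplecticGroup (Fin n) ℝ) : Prop :=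
  (S : Matrix (Fin n ⊕ Fin n) (Fin n ⊕ Fin n) ℝ) = Matrix.fromBlocks 0 1 (-1) 0 ∧
    ∀ ψ : L2Space n, Integrable (⇑ψ) (volume : Measure (EuclideanSpace ℝ (Fin n))) →
      (U ψ : EuclideanSpace ℝ (Fin n) → ℂ) =ᵐ[volume] fun x =>
        (1 / (2 * (Real.pi : ℂ) * Complex.I * (hbar : ℂ))) ^ ((n : ℂ) / 2) *
          ∫ x' : EuclideanSpace ℝ (Fin n),
            Complex.exp (-(Complex.I / (hbar : ℂ)) * ((inner ℝ x x' : ℝ) : ℂ)) * ψ x'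

/-- The graph of the covering projection `Mp(n) → Sp(n)`: the subgroup of
`U(L²(ℝⁿ)) × Sp(n)` generated by the generators of `Mp(n)` paired with their projections. -/
def metaplecticGraph (n : ℕ) (hbar : ℝ) :
    Subgroup ((L2Space n ≃ₗᵢ[ℂ] L2Space n) × Matrix.symplecticGroup (Fin n) ℝ) :=
  Subgroup.closure {US | IsChirpPair hbar US.1 US.2 ∨ IsRescalingPair US.1 US.2 ∨
    IsFourierPair hbar US.1 US.2}

/-- The metaplectic group `Mp(n)`, a group of unitary operators on `L²(ℝⁿ)`. -/
def metaplecticGroup (n : ℕ) (hbar : ℝ) : Subgroup (L2Space n ≃ₗᵢ[ℂ] L2Space n) :=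
  (metaplecticGraph n hbar).map (MonoidHom.fst _ _)

/-- The operator `U ∈ Mp(n)` covers `S ∈ Sp(n)`. -/
def MetaplecticCovers {n : ℕ} (hbar : ℝ)
    (U : L2Space n ≃ₗᵢ[ℂ] L2Space n) (S : Matrix.symplecticGroup (Fin n) ℝ) : Prop :=
  (U, S) ∈ metaplecticGraph n hbar

end

noncomputable section

/-! ### Linear symplectic geometry -/

/-! Everything is transported to the standard frame. Nondegeneracy of `ω` gives coordinates `T₁` on
`ℓ` and `T₂` on `ℓ'` such that `X_ℓ` is the image of the ball of radius `√ħ` and `ω(T₁x, T₂p) =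
-x·p` (`exists_frame_param`). By Cauchy–Schwarz the polar dual is then the `T₂`-image of the same
ball, and `(x, p) ↦ T₁x + T₂p` is a symplectic map `S₀` carrying `Bⁿ(√ħ) × Bⁿ(√ħ)` onto the product.

Linear automorphisms scale all volumes by one factor, so the John ellipsoid question only concerns
this product of balls. It lies in the cube of half-side `√ħ`. An ellipsoid `c + T(B)` in that cube
has rows of `T` of length at most `√ħ`; if `|det T|` is at least that of the ball, `log λ ≤ λ - 1`
on the eigenvalues of the normalized `TTᵀ` forces that matrix to be the identity, and then `c = 0`
(`image_eq_closedBall_of_subset_cube`). Hence `Ω = S₀(B(√ħ))`.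

For the states, `Wψ(z) = (πħ)⁻ⁿ ⟨ψ, R(z)ψ⟩` with `R(z)` the Grossmann–Royer reflections. The
relation `Ŝ R(z) = R(Sz) Ŝ` holds for the generators, hence on the whole metaplectic group, so
`W(Ŝφ₀)` is the Gaussian of covariance `(ħ/2) SSᵀ`, whose ellipsoid is the blob of `S`. Conversely,
the ellipsoid determines the covariance, and Fourier inversion shows that the Wigner transform
determines a state up to a unimodular factor (`eq_phase_smul_of_wignerTransform_eq`). Every `S` is
covered because shears, rescalings and `J` generate the symplectic group (`coveredSubgroup_eq_top`).

Finally `ψ_{X,Y}` is a chirp of a rescaling of `φ₀`, covering some `R` with `RRᵀ = gaussianGram X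
Y`. Every `SSᵀ` has this form for exactly one pair `(X, Y)`, which gives existence and uniqueness.
-/

@[simp] lemma posPart_apply {n : ℕ} (z : PhaseSpace n) (i : Fin n) :
    posPart z i = z (Sum.inl i) := rfl

@[simp] lemma momPart_apply {n : ℕ} (z : PhaseSpace n) (i : Fin n) :
    momPart z i = z (Sum.inr i) := rfl

/-- The point `(x, p)` of phase space. -/
def phasePoint {n : ℕ} (x p : EuclideanSpace ℝ (Fin n)) : PhaseSpace n :=
  WithLp.toLp 2 (Sum.elim x p)

@[simp] lemma posPart_phasePoint {n : ℕ} (x p : EuclideanSpace ℝ (Fin n)) :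
    posPart (phasePoint x p) = x := rfl

@[simp] lemma momPart_phasePoint {n : ℕ} (x p : EuclideanSpace ℝ (Fin n)) :
    momPart (phasePoint x p) = p := rfl

/-- The position part as a linear map. -/
def posPartₗ (n : ℕ) : PhaseSpace n →ₗ[ℝ] EuclideanSpace ℝ (Fin n) where
  toFun := posPart
  map_add' _ _ := rfl
  map_smul' _ _ := rfl

/-- The momentum part as a linear map. -/
def momPartₗ (n : ℕ) : PhaseSpace n →ₗ[ℝ] EuclideanSpace ℝ (Fin n) where
  toFun := momPart
  map_add' _ _ := rfl
  map_smul' _ _ := rfl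

lemma norm_sq_eq_parts {n : ℕ} (z : PhaseSpace n) :
    ‖z‖ ^ 2 = ‖posPart z‖ ^ 2 + ‖momPart z‖ ^ 2 := by
  simp [EuclideanSpace.norm_sq_eq, Fintype.sum_sum_type]

/-- The symplectic form as a bilinear form. -/
def sympBilin (n : ℕ) : PhaseSpace n →ₗ[ℝ] PhaseSpace n →ₗ[ℝ] ℝ :=
  LinearMap.mk₂ ℝ sympForm
    (fun a b c => by
      change inner ℝ (momPart a + momPart b) _ - inner ℝ (posPart a + posPart b) _ = _
      simp only [sympForm, inner_add_left]; ring)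
    (fun r a c => by
      change inner ℝ (r • momPart a) _ - inner ℝ (r • posPart a) _ = _
      simp only [sympForm, real_inner_smul_left, smul_eq_mul]; ring)
    (fun a b c => by
      change inner ℝ _ (posPart b + posPart c) - inner ℝ _ (momPart b + momPart c) = _
      simp only [sympForm, inner_add_right]; ring)
    (fun r a c => by
      change inner ℝ _ (r • posPart c) - inner ℝ _ (r • momPart c) = _
      simp only [sympForm, real_inner_smul_right, smul_eq_mul]; ring)

@[simp] lemma sympBilin_apply {n : ℕ} (z z' : PhaseSpace n) :
    sympBilin n z z' = sympForm z z' := rfl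

lemma sympForm_antisymm {n : ℕ} (z z' : PhaseSpace n) : sympForm z z' = -sympForm z' z := by
  simp only [sympForm, real_inner_comm]; ring

/-- Pairing `z' = (x', p')` with the rotated vector `(-p', x')` gives `‖z'‖²`. -/
lemma eq_zero_of_sympForm_eq_zero {n : ℕ} {z' : PhaseSpace n} (h : ∀ z, sympForm z z' = 0) :
    z' = 0 := by
  have h1 := h (phasePoint (-momPart z') (posPart z'))
  simp only [sympForm, momPart_phasePoint, posPart_phasePoint, inner_neg_left,
    real_inner_self_eq_norm_sq] at h1
  have h2 := norm_sq_eq_parts z'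
  have : ‖z'‖ ^ 2 = 0 := by linarith
  simpa using this

lemma inner_toEuclideanLin {ι : Type*} [Fintype ι] [DecidableEq ι] (A : Matrix ι ι ℝ)
    (x y : EuclideanSpace ℝ ι) :
    inner ℝ (Matrix.toEuclideanLin A x) y = inner ℝ x (Matrix.toEuclideanLin A.transpose y) := by
  have := LinearMap.adjoint_inner_right (Matrix.toEuclideanLin A) x y
  rw [← Matrix.toEuclideanLin_conjTranspose_eq_adjoint, Matrix.conjTranspose_eq_transpose_of_trivial]
    at this
  exact this.symm

lemma toEuclideanLin_mul_apply {ι : Type*} [Fintype ι] [DecidableEq ι] (A B : Matrix ι ι ℝ)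
    (x : EuclideanSpace ℝ ι) : Matrix.toEuclideanLin (A * B) x =
      Matrix.toEuclideanLin A (Matrix.toEuclideanLin B x) := by
  simp [Matrix.toLpLin_apply, Matrix.mulVec_mulVec]

lemma toEuclideanLin_one_apply {ι : Type*} [Fintype ι] [DecidableEq ι]
    (x : EuclideanSpace ℝ ι) : Matrix.toEuclideanLin (1 : Matrix ι ι ℝ) x = x := by
  simp

lemma sympForm_eq_inner_J {n : ℕ} (z z' : PhaseSpace n) :
    sympForm z z' = inner ℝ z (Matrix.toEuclideanLin (Matrix.J (Fin n) ℝ) z') := by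
  simp [sympForm, PiLp.inner_apply, Fintype.sum_sum_type, Matrix.toLpLin_apply, Matrix.mulVec,
    dotProduct, Matrix.J, Matrix.one_apply, Finset.sum_neg_distrib]
  ring

lemma matrix_eq_of_inner_eq {ι : Type*} [Fintype ι] [DecidableEq ι] {A B : Matrix ι ι ℝ}
    (h : ∀ x y : EuclideanSpace ℝ ι, inner ℝ x (Matrix.toEuclideanLin A y) =
      inner ℝ x (Matrix.toEuclideanLin B y)) : A = B := by
  apply Matrix.toEuclideanLin.injective
  ext1 y
  exact ext_inner_left ℝ fun x => h x y

lemma mem_symplecticGroup_iff_sympForm {n : ℕ} (A : Matrix (Fin n ⊕ Fin n) (Fin n ⊕ Fin n) ℝ) :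
    A ∈ Matrix.symplecticGroup (Fin n) ℝ ↔ ∀ z z' : PhaseSpace n,
      sympForm (Matrix.toEuclideanLin A z) (Matrix.toEuclideanLin A z') = sympForm z z' := by
  rw [SymplecticGroup.mem_iff']
  have key : ∀ z z' : PhaseSpace n,
      sympForm (Matrix.toEuclideanLin A z) (Matrix.toEuclideanLin A z') =
      inner ℝ z (Matrix.toEuclideanLin (A.transpose * Matrix.J (Fin n) ℝ * A) z') := fun z z' => by
    rw [sympForm_eq_inner_J, inner_toEuclideanLin, toEuclideanLin_mul_apply,
      toEuclideanLin_mul_apply]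
  refine ⟨fun h z z' => by rw [key, h, sympForm_eq_inner_J], fun h => ?_⟩
  exact matrix_eq_of_inner_eq fun x y => by rw [← key, h, sympForm_eq_inner_J]

/-- The linear automorphism of phase space defined by a symplectic matrix. -/
def sympEquiv {n : ℕ} (S : Matrix.symplecticGroup (Fin n) ℝ) : PhaseSpace n ≃ₗ[ℝ] PhaseSpace n :=
  LinearEquiv.ofLinearMap (Matrix.toEuclideanLin S.1) (Matrix.toEuclideanLin (S⁻¹).1)
    (by ext1 z; simp [← toEuclideanLin_mul_apply, ← Submonoid.coe_mul])
    (by ext1 z; simp [← toEuclideanLin_mul_apply, ← Submonoid.coe_mul])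

lemma sympEquiv_apply {n : ℕ} (S : Matrix.symplecticGroup (Fin n) ℝ) (z : PhaseSpace n) :
    sympEquiv S z = Matrix.toEuclideanLin S.1 z := rfl

lemma sympEquiv_symm_apply {n : ℕ} (S : Matrix.symplecticGroup (Fin n) ℝ) (z : PhaseSpace n) :
    (sympEquiv S).symm z = Matrix.toEuclideanLin (S⁻¹).1 z := rfl

lemma image_closedBall_smul {V W : Type*} [NormedAddCommGroup V] [NormedSpace ℝ V]
    [AddCommGroup W] [Module ℝ W] (T : V →ₗ[ℝ] W) {r : ℝ} (hr : 0 < r) :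
    (r • T) '' Metric.closedBall 0 1 = T '' Metric.closedBall 0 r := by
  ext w
  constructor
  · rintro ⟨v, hv, rfl⟩
    refine ⟨r • v, ?_, by simp⟩
    rw [mem_closedBall_zero_iff] at hv ⊢
    rw [norm_smul, Real.norm_of_nonneg hr.le]
    nlinarith
  · rintro ⟨v, hv, rfl⟩
    refine ⟨r⁻¹ • v, ?_, by simp [smul_smul, hr.ne']⟩
    rw [mem_closedBall_zero_iff] at hv ⊢
    rw [norm_smul, norm_inv, Real.norm_of_nonneg hr.le]
    rwa [inv_mul_le_iff₀ hr, mul_one]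

/-- Parametrization of a Lagrangian frame adapted to an ellipsoid in its first member. -/
theorem exists_frame_param {n : ℕ} {r : ℝ} (hr : 0 < r) {ℓ ℓ' : Submodule ℝ (PhaseSpace n)}
    (hframe : IsLagrangianFrame ℓ ℓ') {X : Set (PhaseSpace n)} (hX : IsCenteredEllipsoidOn ℓ X) :
    ∃ T₁ T₂ : EuclideanSpace ℝ (Fin n) →ₗ[ℝ] PhaseSpace n,
      LinearMap.range T₁ = ℓ ∧ LinearMap.range T₂ = ℓ' ∧ X = T₁ '' Metric.closedBall 0 r ∧
      ∀ x p, sympForm (T₁ x) (T₂ p) = -inner ℝ x p := by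
  obtain ⟨⟨hd, hl⟩, ⟨hd', hl'⟩, hinf⟩ := hframe
  obtain ⟨T, hT, rfl⟩ := hX
  have hr' : LinearMap.range (r⁻¹ • T) = ℓ := by
    rw [LinearMap.range_smul _ _ (inv_ne_zero hr.ne'), hT]
  set T₁ := r⁻¹ • T with hT₁
  have hsup : ℓ ⊔ ℓ' = ⊤ := by
    apply Submodule.eq_top_of_finrank_eq
    have := Submodule.finrank_sup_add_finrank_inf_eq ℓ ℓ'
    rw [hinf, finrank_bot, hd, hd'] at this
    simpa using this
  -- the pairing of the two members of the frame
  let Φ : ℓ' →ₗ[ℝ] (EuclideanSpace ℝ (Fin n) →ₗ[ℝ] ℝ) :=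
    -((sympBilin n).comp T₁).flip.comp ℓ'.subtype
  have hΦ : ∀ z' x, Φ z' x = -sympForm (T₁ x) z' := fun z' x => rfl
  -- A kernel vector is `ω`-orthogonal to `ℓ`, and to `ℓ'` because `ℓ'` is Lagrangian, hence to the
  -- whole space.
  have hinj : Function.Injective Φ := by
    rw [injective_iff_map_eq_zero]
    intro z' hz'
    apply Subtype.ext
    apply eq_zero_of_sympForm_eq_zero
    intro z
    have hz : z ∈ ℓ ⊔ ℓ' := by rw [hsup]; trivial
    obtain ⟨a, ha, b, hb, rfl⟩ := Submodule.mem_sup.1 hz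
    rw [← hr'] at ha
    obtain ⟨x, rfl⟩ := ha
    have h1 : -sympForm (T₁ x) z' = 0 := by rw [← hΦ, hz']; rfl
    rw [← sympBilin_apply, map_add, LinearMap.add_apply, sympBilin_apply, sympBilin_apply,
      hl' b hb z' z'.2]
    linarith
  have hfr : Module.finrank ℝ ℓ' = Module.finrank ℝ (EuclideanSpace ℝ (Fin n) →ₗ[ℝ] ℝ) := by
    rw [hd', Module.finrank_linearMap_self]; simp
  let e := LinearEquiv.ofInjectiveOfFinrankEq Φ hinj hfr
  let D : EuclideanSpace ℝ (Fin n) →ₗ[ℝ] (EuclideanSpace ℝ (Fin n) →ₗ[ℝ] ℝ) := innerₗ _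
  have hD : Function.Injective D := by
    rw [injective_iff_map_eq_zero]
    intro x hx
    have : D x x = 0 := by rw [hx]; rfl
    simpa [D] using this
  let d := LinearEquiv.ofInjectiveOfFinrankEq D hD
    (by rw [Module.finrank_linearMap_self])
  have hpair : ∀ x p, sympForm (T₁ x) (e.symm (d p)) = -inner ℝ x p := by
    intro x p
    have h1 : Φ (e.symm (d p)) = D p := e.apply_symm_apply (d p)
    have h2 := congrArg (fun f => f x) h1
    simp only [hΦ] at h2
    rw [real_inner_comm]
    have h3 : D p x = inner ℝ p x := rfl
    linarith
  refine ⟨T₁, ℓ'.subtype.comp (e.symm.toLinearMap.comp d.toLinearMap), hr', ?_, ?_, hpair⟩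
  · rw [LinearMap.range_comp, LinearMap.range_eq_top.2, Submodule.map_top, Submodule.range_subtype]
    exact e.symm.surjective.comp d.surjective
  · rw [← image_closedBall_smul _ hr, hT₁, smul_smul, mul_inv_cancel₀ hr.ne', one_smul]

/-- In these coordinates the dual is the Euclidean polar of a ball at level `ħ`. The radius `√ħ` is
the self-dual one. -/
theorem lagrangianPolarDual_param {n : ℕ} {hbar : ℝ} (hpos : 0 < hbar)
    {ℓ' : Submodule ℝ (PhaseSpace n)}
    {T₁ T₂ : EuclideanSpace ℝ (Fin n) →ₗ[ℝ] PhaseSpace n} (hT₂ : LinearMap.range T₂ = ℓ')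
    (h : ∀ x p, sympForm (T₁ x) (T₂ p) = -inner ℝ x p) :
    lagrangianPolarDual hbar ℓ' (T₁ '' Metric.closedBall 0 (Real.sqrt hbar)) =
      T₂ '' Metric.closedBall 0 (Real.sqrt hbar) := by
  have hs : 0 < Real.sqrt hbar := Real.sqrt_pos.2 hpos
  have hss : Real.sqrt hbar * Real.sqrt hbar = hbar := Real.mul_self_sqrt hpos.le
  ext z'
  constructor
  · rintro ⟨hz, hle⟩
    rw [← hT₂] at hz
    obtain ⟨p, rfl⟩ := hz
    refine ⟨p, ?_, rfl⟩
    rw [mem_closedBall_zero_iff]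
    rcases eq_or_ne p 0 with rfl | hp
    · simp
    have hp' : 0 < ‖p‖ := norm_pos_iff.2 hp
    -- The equality case of Cauchy–Schwarz: the point of the sphere of radius `√ħ` opposite to `p`.
    have h1 := hle (T₁ (-(Real.sqrt hbar / ‖p‖) • p)) ⟨_, ?_, rfl⟩
    · rw [h, real_inner_smul_left, real_inner_self_eq_norm_sq] at h1
      have h2 : Real.sqrt hbar / ‖p‖ * ‖p‖ ^ 2 = Real.sqrt hbar * ‖p‖ := by field_simp
      nlinarith
    · rw [mem_closedBall_zero_iff, norm_smul, norm_neg, norm_div, norm_norm,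
        Real.norm_of_nonneg hs.le, div_mul_cancel₀ _ hp'.ne']
  · rintro ⟨p, hp, rfl⟩
    refine ⟨hT₂ ▸ LinearMap.mem_range_self _ _, ?_⟩
    rintro _ ⟨x, hx, rfl⟩
    rw [mem_closedBall_zero_iff] at hp hx
    rw [h]
    calc -inner ℝ x p ≤ |inner ℝ x p| := neg_le_abs _
      _ ≤ ‖x‖ * ‖p‖ := abs_real_inner_le_norm _ _
      _ ≤ Real.sqrt hbar * Real.sqrt hbar := by gcongr
      _ = hbar := hss

/-- The product `Bⁿ(r) × Bⁿ(r)` of two balls. -/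
def ballProduct (n : ℕ) (r : ℝ) : Set (PhaseSpace n) :=
  {z | ‖posPart z‖ ≤ r ∧ ‖momPart z‖ ≤ r}

/-- The form vanishes on each Lagrangian, so only the cross terms survive, and the normalized
pairing makes them the standard ones. -/
theorem exists_symplectic_frame {n : ℕ} {ℓ ℓ' : Submodule ℝ (PhaseSpace n)}
    (hframe : IsLagrangianFrame ℓ ℓ')
    {T₁ T₂ : EuclideanSpace ℝ (Fin n) →ₗ[ℝ] PhaseSpace n}
    (hT₁ : LinearMap.range T₁ = ℓ) (hT₂ : LinearMap.range T₂ = ℓ')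
    (h : ∀ x p, sympForm (T₁ x) (T₂ p) = -inner ℝ x p) :
    ∃ S : Matrix.symplecticGroup (Fin n) ℝ,
      ∀ z, sympEquiv S z = T₁ (posPart z) + T₂ (momPart z) := by
  let F : PhaseSpace n →ₗ[ℝ] PhaseSpace n := T₁.comp (posPartₗ n) + T₂.comp (momPartₗ n)
  have hF : ∀ z, F z = T₁ (posPart z) + T₂ (momPart z) := fun z => rfl
  have hmat : ∀ z, Matrix.toEuclideanLin (Matrix.toEuclideanLin.symm F) z = F z := fun z => by
    rw [LinearEquiv.apply_symm_apply]
  refine ⟨⟨Matrix.toEuclideanLin.symm F, ?_⟩, fun z => by rw [sympEquiv_apply, hmat, hF]⟩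
  rw [mem_symplecticGroup_iff_sympForm]
  intro z z'
  rw [hmat, hmat, hF, hF, ← sympBilin_apply]
  simp only [map_add, LinearMap.add_apply, sympBilin_apply]
  subst hT₁ hT₂
  rw [hframe.1.2 _ (LinearMap.mem_range_self T₁ _) _ (LinearMap.mem_range_self T₁ _),
    hframe.2.1.2 _ (LinearMap.mem_range_self T₂ _) _ (LinearMap.mem_range_self T₂ _),
    h, sympForm_antisymm (T₂ _), h, sympForm, real_inner_comm (posPart z')]
  ring

lemma frameProduct_param {n : ℕ} {r : ℝ} {T₁ T₂ : EuclideanSpace ℝ (Fin n) →ₗ[ℝ] PhaseSpace n}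
    {S : Matrix.symplecticGroup (Fin n) ℝ}
    (hS : ∀ z, sympEquiv S z = T₁ (posPart z) + T₂ (momPart z)) :
    frameProduct (T₁ '' Metric.closedBall 0 r) (T₂ '' Metric.closedBall 0 r) =
      sympEquiv S '' ballProduct n r := by
  ext z
  constructor
  · rintro ⟨_, ⟨x, hx, rfl⟩, _, ⟨p, hp, rfl⟩, rfl⟩
    exact ⟨phasePoint x p, ⟨by simpa using hx, by simpa using hp⟩, by simp [hS]⟩
  · rintro ⟨w, ⟨hx, hp⟩, rfl⟩
    exact ⟨_, ⟨posPart w, by simpa using hx, rfl⟩, _, ⟨momPart w, by simpa using hp, rfl⟩, hS w⟩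

/-! ### The John ellipsoid -/

/-- The equality case of AM–GM: each eigenvalue contributes `λ - 1 - log λ ≥ 0`, while the trace and
determinant bounds make the sum nonpositive. Each term vanishes, so `λ = 1`. -/
theorem eq_one_of_posDef_of_diag_le_one {ι : Type*} [Fintype ι] [DecidableEq ι]
    {G : Matrix ι ι ℝ} (hG : G.PosDef) (hd : ∀ i, G i i ≤ 1) (hdet : 1 ≤ G.det) : G = 1 := by
  have hH := hG.isHermitian
  have hpos : ∀ i, 0 < hH.eigenvalues i := hG.eigenvalues_pos
  have hprod : G.det = ∏ i, hH.eigenvalues i := by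
    simpa using hH.det_eq_prod_eigenvalues
  have htr : ∑ i, G i i = ∑ i, hH.eigenvalues i := by
    simpa [Matrix.trace] using hH.trace_eq_sum_eigenvalues
  have h1 : 0 ≤ ∑ i, Real.log (hH.eigenvalues i) := by
    rw [← Real.log_prod (fun i _ => (hpos i).ne'), ← hprod]
    exact Real.log_nonneg hdet
  have h2 : ∑ i, (hH.eigenvalues i - 1) ≤ 0 := by
    rw [Finset.sum_sub_distrib, ← htr, ← Finset.sum_sub_distrib]
    exact Finset.sum_nonpos fun i _ => by linarith [hd i]
  have h3 : ∀ i ∈ Finset.univ, hH.eigenvalues i - 1 - Real.log (hH.eigenvalues i) = 0 := by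
    rw [← Finset.sum_eq_zero_iff_of_nonneg]
    · apply le_antisymm
      · rw [Finset.sum_sub_distrib]; linarith
      · exact Finset.sum_nonneg fun i _ => by
          linarith [Real.log_le_sub_one_of_pos (hpos i)]
    · intro i _
      linarith [Real.log_le_sub_one_of_pos (hpos i)]
  have h4 : ∀ i, hH.eigenvalues i = 1 := by
    intro i
    by_contra hne
    have := Real.log_lt_sub_one_of_pos (hpos i) hne
    linarith [h3 i (Finset.mem_univ i)]
  have h5 := hH.spectral_theorem
  have h6 : (Matrix.diagonal (RCLike.ofReal ∘ hH.eigenvalues) : Matrix ι ι ℝ) = 1 := by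
    rw [← Matrix.diagonal_one]
    congr 1
    ext i
    simp [h4 i]
  rw [h6, map_one] at h5
  exact h5

/-- A (not necessarily centered) ellipsoid inside the cube `[-r, r]^ι` whose volume is at least
that of the ball of radius `r` is that ball. -/
theorem image_eq_closedBall_of_subset_cube {ι : Type*} [Fintype ι] [DecidableEq ι] {r : ℝ}
    (hr : 0 < r) (c : EuclideanSpace ℝ ι) (T : EuclideanSpace ℝ ι ≃ₗ[ℝ] EuclideanSpace ℝ ι)
    (hsub : ∀ z ∈ Metric.closedBall (0 : EuclideanSpace ℝ ι) 1, ∀ i, |(c + T z) i| ≤ r)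
    (hdet : r ^ Fintype.card ι ≤ |LinearMap.det (T : EuclideanSpace ℝ ι →ₗ[ℝ] EuclideanSpace ℝ ι)|) :
    (fun z => c + T z) '' Metric.closedBall 0 1 = Metric.closedBall 0 r := by
  obtain ⟨M, hM⟩ : ∃ M : Matrix ι ι ℝ, Matrix.toEuclideanLin M = T.toLinearMap :=
    Matrix.toEuclideanLin.surjective _
  have hMT : ∀ z, T z = Matrix.toEuclideanLin M z := fun z => by rw [hM]; rfl
  have hdM : |M.det| = |LinearMap.det T.toLinearMap| := by
    rw [← hM, Matrix.toEuclideanLin_eq_toLin_orthonormal, LinearMap.det_toLin]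
  let row : ι → EuclideanSpace ℝ ι := fun i => WithLp.toLp 2 (M i)
  have hrow : ∀ z i, T z i = inner ℝ (row i) z := by
    intro z i
    rw [hMT]
    simp [row, Matrix.toLpLin_apply, Matrix.mulVec, dotProduct, PiLp.inner_apply, mul_comm]
  have hbound : ∀ i, ‖row i‖ + |c i| ≤ r := by
    intro i
    -- The `i`-th coordinate is extremal on the ellipsoid at `±` the normalized `i`-th row. For a
    -- zero row the convention `0⁻¹ = 0` makes the test point the origin.
    have key : ∀ s : ℝ, |s| = 1 → |c i + s * ‖row i‖| ≤ r := by
      intro s hs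
      have := hsub ((s * ‖row i‖⁻¹) • row i) ?_ i
      · rw [PiLp.add_apply, hrow, real_inner_smul_right, real_inner_self_eq_norm_sq] at this
        rcases eq_or_ne ‖row i‖ 0 with h0 | h0
        · simpa [h0] using this
        · convert this using 3
          field_simp
      · rw [mem_closedBall_zero_iff, norm_smul, Real.norm_eq_abs, abs_mul, hs, one_mul, abs_inv,
          abs_norm]
        exact inv_mul_le_one
    have h1 := abs_le.1 (key 1 (by simp))
    have h2 := abs_le.1 (key (-1) (by simp))
    rcases abs_cases (c i) with ⟨h, _⟩ | ⟨h, _⟩ <;> rw [h] <;> linarith [h1.1, h1.2, h2.1, h2.2]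
  have hMdet : M.det ≠ 0 := by
    intro h0
    rw [h0, abs_zero] at hdM
    have : 0 < r ^ Fintype.card ι := by positivity
    linarith
  let M' : Matrix ι ι ℝ := r⁻¹ • M
  have hM'det : 1 ≤ |M'.det| := by
    rw [Matrix.det_smul, abs_mul, hdM, abs_of_pos (by positivity), inv_pow,
      ← div_eq_inv_mul, one_le_div (by positivity)]
    exact hdet
  have hM'u : IsUnit M' := by
    rw [Matrix.isUnit_iff_isUnit_det, isUnit_iff_ne_zero]
    intro h0
    rw [h0, abs_zero] at hM'det
    linarith
  have hG : (M' * M'.transpose).PosDef := by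
    have := Matrix.PosDef.mul_conjTranspose_self M' (Matrix.vecMul_injective_of_isUnit hM'u)
    rwa [Matrix.conjTranspose_eq_transpose_of_trivial] at this
  have hdiag : ∀ i, (M' * M'.transpose) i i = (r⁻¹ * ‖row i‖) ^ 2 := by
    intro i
    rw [mul_pow, EuclideanSpace.norm_sq_eq, Finset.mul_sum]
    simp only [M', row, Matrix.mul_apply, Matrix.transpose_apply, Matrix.smul_apply, smul_eq_mul,
      Real.norm_eq_abs, sq_abs]
    exact Finset.sum_congr rfl fun j _ => by ring
  have hG1 : M' * M'.transpose = 1 := by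
    refine eq_one_of_posDef_of_diag_le_one hG (fun i => ?_) ?_
    · rw [hdiag]
      have h1 : r⁻¹ * ‖row i‖ ≤ 1 := by
        rw [inv_mul_le_iff₀ hr, mul_one]
        linarith [hbound i, abs_nonneg (c i)]
      have h2 : 0 ≤ r⁻¹ * ‖row i‖ := by positivity
      nlinarith
    · rw [Matrix.det_mul, Matrix.det_transpose, ← abs_mul_abs_self]
      nlinarith
  -- Unit diagonal entries mean that all rows have length exactly `r`, which leaves no room for the
  -- center in `hbound`.
  have hc : c = 0 := by
    ext i
    have h1 := hdiag i
    rw [hG1, Matrix.one_apply_eq, eq_comm, pow_eq_one_iff_of_nonneg (by positivity) two_ne_zero,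
      inv_mul_eq_one₀ hr.ne'] at h1
    have := hbound i
    rw [← h1] at this
    simpa using (abs_nonpos_iff.1 (by linarith : |c i| ≤ 0))
  have hnorm : ∀ z, ‖T z‖ = r * ‖z‖ := by
    intro z
    have hT : T z = r • Matrix.toEuclideanLin M' z := by
      rw [hMT]
      simp [M', smul_smul, hr.ne']
    have h1 : ‖Matrix.toEuclideanLin M' z‖ ^ 2 = ‖z‖ ^ 2 := by
      rw [← real_inner_self_eq_norm_sq, inner_toEuclideanLin, ← toEuclideanLin_mul_apply,
        mul_eq_one_comm.1 hG1, toEuclideanLin_one_apply, real_inner_self_eq_norm_sq]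
    rw [hT, norm_smul, Real.norm_of_nonneg hr.le,
      (pow_left_inj₀ (norm_nonneg _) (norm_nonneg _) two_ne_zero).1 h1]
  subst hc
  ext w
  simp only [zero_add, Set.mem_image, mem_closedBall_zero_iff]
  constructor
  · rintro ⟨z, hz, rfl⟩
    rw [hnorm]
    nlinarith
  · intro hw
    refine ⟨T.symm w, ?_, by simp⟩
    have := hnorm (T.symm w)
    rw [LinearEquiv.apply_symm_apply] at this
    rw [this] at hw
    nlinarith

lemma volume_affine_image_closedBall {n : ℕ} (c : PhaseSpace n)
    (T : PhaseSpace n ≃ₗ[ℝ] PhaseSpace n) (r : ℝ) :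
    volume ((fun z => c + T z) '' Metric.closedBall 0 r) =
      ENNReal.ofReal |LinearMap.det (T : PhaseSpace n →ₗ[ℝ] PhaseSpace n)| *
        volume (Metric.closedBall (0 : PhaseSpace n) r) := by
  have : (fun z => c + T z) '' Metric.closedBall 0 r =
      (fun z => c + z) '' ((T : PhaseSpace n →ₗ[ℝ] PhaseSpace n) '' Metric.closedBall 0 r) := by
    rw [Set.image_image]; rfl
  rw [this, Set.image_add_left, measure_preimage_add, Measure.addHaar_image_linearMap]

/-- Pulling a competitor back by `e` divides its determinant by that of `e`. Uniqueness is proved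
for every inscribed ellipsoid at least as large as the ball image, and maximality follows from it by
contradiction. -/
theorem johnEllipsoid_ballProduct {n : ℕ} {r : ℝ} (hr : 0 < r)
    (e : PhaseSpace n ≃ₗ[ℝ] PhaseSpace n) :
    IsJohnEllipsoid (e '' ballProduct n r) (e '' Metric.closedBall 0 r) ∧
      ∀ Ω, IsJohnEllipsoid (e '' ballProduct n r) Ω → Ω = e '' Metric.closedBall 0 r := by
  have hball : e '' Metric.closedBall 0 r =
      (fun z => (0 : PhaseSpace n) + (e.trans (LinearEquiv.smulOfNeZero ℝ _ r hr.ne')) z) ''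
        Metric.closedBall 0 1 := by
    rw [← LinearEquiv.coe_coe e, ← image_closedBall_smul _ hr]
    simp
  have hdetr : |LinearMap.det ((e.trans (LinearEquiv.smulOfNeZero ℝ _ r hr.ne') :
      PhaseSpace n ≃ₗ[ℝ] PhaseSpace n) : PhaseSpace n →ₗ[ℝ] PhaseSpace n)| =
      r ^ Fintype.card (Fin n ⊕ Fin n) * |LinearMap.det (e : PhaseSpace n →ₗ[ℝ] PhaseSpace n)| := by
    have : ((e.trans (LinearEquiv.smulOfNeZero ℝ _ r hr.ne') :
      PhaseSpace n ≃ₗ[ℝ] PhaseSpace n) : PhaseSpace n →ₗ[ℝ] PhaseSpace n) =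
      r • (e : PhaseSpace n →ₗ[ℝ] PhaseSpace n) := by ext; rfl
    rw [this, LinearMap.det_smul, abs_mul, abs_of_pos (by positivity), finrank_euclideanSpace]
  have hvol : volume (e '' Metric.closedBall 0 r) =
      ENNReal.ofReal (r ^ Fintype.card (Fin n ⊕ Fin n) *
        |LinearMap.det (e : PhaseSpace n →ₗ[ℝ] PhaseSpace n)|) *
        volume (Metric.closedBall (0 : PhaseSpace n) 1) := by
    rw [hball, volume_affine_image_closedBall, hdetr]
  have hmain : ∀ Ω, IsEllipsoid Ω → Ω ⊆ e '' ballProduct n r →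
      volume (e '' Metric.closedBall 0 r) ≤ volume Ω → Ω = e '' Metric.closedBall 0 r := by
    rintro _ ⟨c, T, rfl⟩ hsub hle
    rw [hvol, volume_affine_image_closedBall, ENNReal.mul_le_mul_iff_left
      (Metric.measure_closedBall_pos _ _ one_pos).ne' measure_closedBall_lt_top.ne,
      ENNReal.ofReal_le_ofReal_iff (abs_nonneg _)] at hle
    have hcomp : e '' ((fun z => e.symm c + (T.trans e.symm) z) '' Metric.closedBall 0 1) =
        (fun z => c + T z) '' Metric.closedBall 0 1 := by
      rw [Set.image_image]; simp
    rw [← hcomp]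
    congr 1
    apply image_eq_closedBall_of_subset_cube hr
    · intro z hz i
      obtain ⟨w, hw, hwz⟩ := hsub ⟨z, hz, rfl⟩
      have hw' : e.symm c + (T.trans e.symm) z = w := by
        simp only [LinearEquiv.trans_apply, ← map_add, ← hwz, LinearEquiv.symm_apply_apply]
      rw [hw']
      rcases i with i | i
      · exact ((PiLp.norm_apply_le (posPart w) i).trans hw.1)
      · exact ((PiLp.norm_apply_le (momPart w) i).trans hw.2)
    · have : ((T.trans e.symm : PhaseSpace n ≃ₗ[ℝ] PhaseSpace n) :
          PhaseSpace n →ₗ[ℝ] PhaseSpace n) =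
          (e.symm : PhaseSpace n →ₗ[ℝ] PhaseSpace n) ∘ₗ (T : PhaseSpace n →ₗ[ℝ] PhaseSpace n) := rfl
      rw [this, LinearMap.det_comp, abs_mul, LinearEquiv.det_coe_symm, abs_inv, ← div_eq_inv_mul,
        le_div_iff₀ (abs_pos.2 (LinearEquiv.isUnit_det' e).ne_zero)]
      exact hle
  have hin : e '' Metric.closedBall 0 r ⊆ e '' ballProduct n r := by
    apply Set.image_mono
    intro z hz
    rw [mem_closedBall_zero_iff] at hz
    have := norm_sq_eq_parts z
    constructor <;> nlinarith [norm_nonneg z, norm_nonneg (posPart z), norm_nonneg (momPart z)]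
  refine ⟨⟨⟨0, _, hball⟩, hin, fun Ω hΩ hsub => ?_⟩,
    fun Ω hΩ => hmain Ω hΩ.1 hΩ.2.1 (hΩ.2.2 _ ⟨0, _, hball⟩ hin)⟩
  · by_contra hlt
    rw [hmain Ω hΩ hsub (not_le.1 hlt).le] at hlt
    exact hlt le_rfl

/-! ### Weighted composition operators on `L²(ℝⁿ)` -/

/-- The operator `U` acts as `ψ ↦ w · (ψ ∘ e)`. -/
def ActsAs {n : ℕ} (U : L2Space n ≃ₗᵢ[ℂ] L2Space n) (w : EuclideanSpace ℝ (Fin n) → ℂ)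
    (e : EuclideanSpace ℝ (Fin n) → EuclideanSpace ℝ (Fin n)) : Prop :=
  ∀ ψ : L2Space n, (U ψ : EuclideanSpace ℝ (Fin n) → ℂ) =ᵐ[volume] fun x => w x * ψ (e x)

/-- Elements of `L²` are only classes, so the formula for `V` must be pulled back along `e`; null
sets have to pull back to null sets. -/
lemma ActsAs.mul {n : ℕ} {U V : L2Space n ≃ₗᵢ[ℂ] L2Space n}
    {w w' : EuclideanSpace ℝ (Fin n) → ℂ}
    {e e' : EuclideanSpace ℝ (Fin n) → EuclideanSpace ℝ (Fin n)}
    (hU : ActsAs U w e) (hV : ActsAs V w' e')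
    (he : Measure.QuasiMeasurePreserving e volume volume) :
    ActsAs (U * V) (fun x => w x * w' (e x)) (fun x => e' (e x)) := by
  intro ψ
  refine (hU (V ψ)).trans ?_
  filter_upwards [he.ae (hV ψ)] with x hx
  rw [hx, mul_assoc]

lemma ActsAs.eq {n : ℕ} {U V : L2Space n ≃ₗᵢ[ℂ] L2Space n}
    {w w' : EuclideanSpace ℝ (Fin n) → ℂ}
    {e e' : EuclideanSpace ℝ (Fin n) → EuclideanSpace ℝ (Fin n)}
    (hU : ActsAs U w e) (hV : ActsAs V w' e') (hw : ∀ x, w x = w' x) (he : ∀ x, e x = e' x) :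
    U = V := by
  ext1 ψ
  refine Lp.ext ((hU ψ).trans ?_)
  refine Filter.EventuallyEq.trans ?_ (hV ψ).symm
  exact Filter.Eventually.of_forall fun x => by simp only [hw x, he x]

/-- The constant modulus `s` of the weight compensates the Jacobian `s²` of the change of variables.
-/
theorem eLpNorm_weight_mul_comp {n : ℕ}
    (e : EuclideanSpace ℝ (Fin n) ≃ₜ EuclideanSpace ℝ (Fin n))
    {w : EuclideanSpace ℝ (Fin n) → ℂ} {s : ℝ} (hs : 0 < s) (hws : ∀ x, ‖w x‖ = s)
    (he : Measure.map e volume = ENNReal.ofReal (s ^ 2)⁻¹ • volume)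
    (f : EuclideanSpace ℝ (Fin n) → ℂ) :
    eLpNorm (fun x => w x * f (e x)) 2 volume = eLpNorm f 2 volume := by
  have h1 : eLpNorm (fun x => w x * f (e x)) 2 volume =
      eLpNorm ((s : ℂ) • (f ∘ e)) 2 volume := by
    apply eLpNorm_congr_norm_ae
    exact Filter.Eventually.of_forall fun x => by
      simp [hws x, abs_of_pos hs]
  rw [h1, eLpNorm_const_smul, ← e.measurableEmbedding.eLpNorm_map_measure, he,
    eLpNorm_smul_measure_of_ne_top (by simp), smul_eq_mul, ← mul_assoc]
  have h2 : ‖(s : ℂ)‖ₑ = ENNReal.ofReal s := by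
    rw [← ofReal_norm]; simp [abs_of_pos hs]
  rw [h2, ENNReal.ofReal_rpow_of_pos (by positivity), ← ENNReal.ofReal_mul hs.le]
  have h3 : s * (s ^ 2)⁻¹ ^ (1 / 2 : ENNReal).toReal = 1 := by
    rw [ENNReal.toReal_div, ENNReal.toReal_one, ENNReal.toReal_ofNat, ← Real.sqrt_eq_rpow, Real.sqrt_inv, Real.sqrt_sq hs.le,
      mul_inv_cancel₀ hs.ne']
  rw [h3, ENNReal.ofReal_one, one_mul]

lemma quasiMeasurePreserving_of_map_eq_smul {n : ℕ}
    (e : EuclideanSpace ℝ (Fin n) ≃ₜ EuclideanSpace ℝ (Fin n)) {k : ENNReal}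
    (he : Measure.map e volume = k • volume) :
    Measure.QuasiMeasurePreserving e volume volume :=
  ⟨e.continuous.measurable, by rw [he]; exact Measure.smul_absolutelyContinuous⟩

/-- The common source of the reflections, chirps, rescalings and the dilation in the Fourier
generator. Surjectivity comes from dividing by the nowhere vanishing weight. -/
theorem exists_actsAs {n : ℕ} (e : EuclideanSpace ℝ (Fin n) ≃ₜ EuclideanSpace ℝ (Fin n))
    {w : EuclideanSpace ℝ (Fin n) → ℂ} (hw : Continuous w) {s : ℝ} (hs : 0 < s)
    (hws : ∀ x, ‖w x‖ = s)
    (he : Measure.map e volume = ENNReal.ofReal (s ^ 2)⁻¹ • volume) :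
    ∃ U : L2Space n ≃ₗᵢ[ℂ] L2Space n, ActsAs U w e := by
  have hq := quasiMeasurePreserving_of_map_eq_smul e he
  have hmem : ∀ f : EuclideanSpace ℝ (Fin n) → ℂ, MemLp f 2 volume →
      MemLp (fun x => w x * f (e x)) 2 volume := fun f hf =>
    ⟨hw.aestronglyMeasurable.mul (hf.1.comp_quasiMeasurePreserving hq), by
      rw [eLpNorm_weight_mul_comp e hs hws he]; exact hf.2⟩
  let V : L2Space n →ₗᵢ[ℂ] L2Space n :=
    { toFun := fun ψ => (hmem ψ (Lp.memLp ψ)).toLp _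
      map_add' := fun ψ φ => by
        rw [← MemLp.toLp_add]
        refine MemLp.toLp_congr _ _ ?_
        filter_upwards [hq.ae (Lp.coeFn_add ψ φ)] with x hx
        rw [Pi.add_apply, hx, Pi.add_apply, mul_add]
      map_smul' := fun c ψ => by
        rw [RingHom.id_apply, ← MemLp.toLp_const_smul]
        refine MemLp.toLp_congr _ _ ?_
        filter_upwards [hq.ae (Lp.coeFn_smul c ψ)] with x hx
        simp only [hx, Pi.smul_apply, smul_eq_mul]
        ring
      norm_map' := fun ψ => by
        change ‖(hmem ψ (Lp.memLp ψ)).toLp _‖ = ‖ψ‖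
        rw [Lp.norm_toLp, eLpNorm_weight_mul_comp e hs hws he, Lp.norm_def] }
  have hV : ∀ ψ : L2Space n, (V ψ : EuclideanSpace ℝ (Fin n) → ℂ) =ᵐ[volume]
      fun x => w x * ψ (e x) := fun ψ => MemLp.coeFn_toLp (hmem ψ (Lp.memLp ψ))
  have hw0 : ∀ x, w x ≠ 0 := fun x h0 => by
    have := hws x
    rw [h0, norm_zero] at this
    exact hs.ne this
  -- The pushforward of Lebesgue measure is a positive multiple of it, so null sets correspond in
  -- both directions.
  have hsymm : Measure.QuasiMeasurePreserving e.symm volume volume := by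
    refine ⟨e.symm.continuous.measurable, ?_⟩
    have h1 : (volume : Measure (EuclideanSpace ℝ (Fin n))) ≪ Measure.map e volume := by
      rw [he]
      refine Measure.absolutelyContinuous_smul ?_
      rw [Ne, ENNReal.ofReal_eq_zero, not_le]
      positivity
    have h2 := h1.map e.symm.continuous.measurable
    rw [Measure.map_map e.symm.continuous.measurable e.continuous.measurable,
      e.symm_comp_self, Measure.map_id] at h2
    exact h2
  have hsurj : Function.Surjective V := by
    intro φ
    let f : EuclideanSpace ℝ (Fin n) → ℂ := fun x => (w (e.symm x))⁻¹ * φ (e.symm x)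
    have hf : MemLp f 2 volume := by
      refine ⟨?_, ?_⟩
      · refine Continuous.aestronglyMeasurable ?_ |>.mul
          ((Lp.memLp φ).1.comp_quasiMeasurePreserving hsymm)
        exact (hw.comp e.symm.continuous).inv₀ fun x => hw0 _
      · rw [← eLpNorm_weight_mul_comp e hs hws he]
        have : (fun x => w x * f (e x)) = φ := by
          ext x
          simp [f, hw0]
        rw [this]
        exact (Lp.memLp φ).2
    refine ⟨hf.toLp f, Lp.ext ((hV _).trans ?_)⟩
    filter_upwards [hq.ae hf.coeFn_toLp] with x hx
    rw [hx]
    simp [f, hw0]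
  exact ⟨LinearIsometryEquiv.ofSurjective V hsurj, hV⟩

/-! ### Grossmann–Royer reflection operators -/

lemma map_subLeft_volume {n : ℕ} (a : EuclideanSpace ℝ (Fin n)) :
    Measure.map (Homeomorph.subLeft a) volume = ENNReal.ofReal ((1 : ℝ) ^ 2)⁻¹ • volume := by
  simpa using (Measure.measurePreserving_sub_left (volume : Measure (EuclideanSpace ℝ (Fin n))) a).map_eq

/-- The phase `e^{(2i/ħ) p·(x' - x)}` of the Grossmann–Royer operator. -/
def royerPhase {n : ℕ} (hbar : ℝ) (z : PhaseSpace n) (y : EuclideanSpace ℝ (Fin n)) : ℂ :=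
  Complex.exp (((2 / hbar * inner ℝ (momPart z) (y - posPart z) : ℝ) : ℂ) * Complex.I)

lemma continuous_royerPhase {n : ℕ} (hbar : ℝ) (z : PhaseSpace n) :
    Continuous (royerPhase hbar z) := by
  unfold royerPhase
  fun_prop

lemma exists_royer {n : ℕ} (hbar : ℝ) (z : PhaseSpace n) :
    ∃ T : L2Space n ≃ₗᵢ[ℂ] L2Space n,
      ActsAs T (royerPhase hbar z) (Homeomorph.subLeft ((2 : ℝ) • posPart z)) :=
  exists_actsAs _ (continuous_royerPhase hbar z) one_pos
    (fun _ => Complex.norm_exp_ofReal_mul_I _) (map_subLeft_volume _)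

/-- The Grossmann–Royer operator `ψ ↦ (x' ↦ e^{(2i/ħ) p·(x' - x)} ψ(2x - x'))`. -/
def royerOp {n : ℕ} (hbar : ℝ) (z : PhaseSpace n) : L2Space n ≃ₗᵢ[ℂ] L2Space n :=
  (exists_royer hbar z).choose

lemma royerOp_actsAs {n : ℕ} (hbar : ℝ) (z : PhaseSpace n) :
    ActsAs (royerOp hbar z) (royerPhase hbar z) (fun y => (2 : ℝ) • posPart z - y) :=
  (exists_royer hbar z).choose_spec

lemma quasiMeasurePreserving_sub_left' {n : ℕ} (a : EuclideanSpace ℝ (Fin n)) :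
    Measure.QuasiMeasurePreserving (fun y => a - y) volume volume :=
  (Measure.measurePreserving_sub_left (volume : Measure (EuclideanSpace ℝ (Fin n))) a).quasiMeasurePreserving

/-- The Wigner transform is a matrix coefficient of the Grossmann–Royer operators. -/
theorem wignerTransform_eq_inner {n : ℕ} {hbar : ℝ} (hpos : 0 < hbar) (ψ : L2Space n)
    (z : PhaseSpace n) :
    wignerTransform hbar ψ z = (1 / ((Real.pi : ℂ) * hbar)) ^ n *
      inner ℂ ψ (royerOp hbar z ψ) := by
  rw [L2.inner_def]
  have h1 : ∫ a, inner ℂ (ψ a) (royerOp hbar z ψ a) =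
      ∫ a, royerPhase hbar z a * ψ ((2 : ℝ) • posPart z - a) * starRingEnd ℂ (ψ a) := by
    apply integral_congr_ae
    filter_upwards [royerOp_actsAs hbar z ψ] with a ha
    rw [ha, RCLike.inner_apply]
  set F : EuclideanSpace ℝ (Fin n) → ℂ :=
    fun a => royerPhase hbar z a * ψ ((2 : ℝ) • posPart z - a) * starRingEnd ℂ (ψ a) with hF
  -- The substitution `a = x - y/2`, with Jacobian factor `2ⁿ`, turns the Wigner integrand into that
  -- of the inner product.
  have h2 : ∫ y : EuclideanSpace ℝ (Fin n), F (posPart z - (1 / 2 : ℝ) • y) = 2 ^ n * ∫ a, F a := by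
    rw [Measure.integral_comp_smul volume (fun y => F (posPart z - y)) (1 / 2 : ℝ),
      integral_sub_left_eq_self F, finrank_euclideanSpace_fin]
    simp [abs_of_pos]
  rw [h1, wignerTransform]
  have h3 : ∀ y : EuclideanSpace ℝ (Fin n),
      Complex.exp (-(Complex.I / (hbar : ℂ)) * ((inner ℝ (momPart z) y : ℝ) : ℂ)) *
        (ψ (posPart z + (1 / 2 : ℝ) • y) *
          (starRingEnd ℂ) (ψ (posPart z - (1 / 2 : ℝ) • y))) =
      F (posPart z - (1 / 2 : ℝ) • y) := by
    intro y
    have e1 : (2 : ℝ) • posPart z - (posPart z - (1 / 2 : ℝ) • y) =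
        posPart z + (1 / 2 : ℝ) • y := by rw [two_smul]; abel
    have e2 : royerPhase hbar z (posPart z - (1 / 2 : ℝ) • y) =
        Complex.exp (-(Complex.I / (hbar : ℂ)) * ((inner ℝ (momPart z) y : ℝ) : ℂ)) := by
      rw [royerPhase, sub_sub_cancel_left, inner_neg_right, real_inner_smul_right]
      congr 1
      push_cast
      ring
    rw [hF]
    simp only
    rw [e1, e2, mul_assoc]
  rw [integral_congr_ae (Filter.Eventually.of_forall h3), h2, ← mul_assoc, ← mul_pow]
  congr 2
  have : (hbar : ℂ) ≠ 0 := by exact_mod_cast hpos.ne'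
  have : (Real.pi : ℂ) ≠ 0 := by exact_mod_cast Real.pi_ne_zero
  field_simp

/-! ### Symplectic covariance of the Grossmann–Royer operators -/

lemma toEuclideanLin_fromBlocks {n : ℕ} (A B C D : Matrix (Fin n) (Fin n) ℝ) (z : PhaseSpace n) :
    Matrix.toEuclideanLin (Matrix.fromBlocks A B C D) z =
      phasePoint (Matrix.toEuclideanLin A (posPart z) + Matrix.toEuclideanLin B (momPart z))
        (Matrix.toEuclideanLin C (posPart z) + Matrix.toEuclideanLin D (momPart z)) := by
  ext i
  rcases i with i | i <;>
  simp [phasePoint, Matrix.toLpLin_apply, Matrix.mulVec, dotProduct, Fintype.sum_sum_type]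

lemma toEuclideanLin_injective_of_det_ne_zero {n : ℕ} {L : Matrix (Fin n) (Fin n) ℝ}
    (hL : L.det ≠ 0) (x : EuclideanSpace ℝ (Fin n)) :
    Matrix.toEuclideanLin L (Matrix.toEuclideanLin L⁻¹ x) = x := by
  rw [← toEuclideanLin_mul_apply, Matrix.mul_nonsing_inv _ (isUnit_iff_ne_zero.2 hL),
    toEuclideanLin_one_apply]

lemma det_toEuclideanLin {n : ℕ} (L : Matrix (Fin n) (Fin n) ℝ) :
    LinearMap.det (Matrix.toEuclideanLin L) = L.det := by
  rw [Matrix.toEuclideanLin_eq_toLin_orthonormal, LinearMap.det_toLin]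

lemma quasiMeasurePreserving_toEuclideanLin {n : ℕ} {L : Matrix (Fin n) (Fin n) ℝ}
    (hL : L.det ≠ 0) :
    Measure.QuasiMeasurePreserving (Matrix.toEuclideanLin L) volume volume :=
  Measure.LinearMap.quasiMeasurePreserving _ _ (by rwa [det_toEuclideanLin])

theorem chirp_covariant {n : ℕ} {hbar : ℝ} {U : L2Space n ≃ₗᵢ[ℂ] L2Space n}
    {S : Matrix.symplecticGroup (Fin n) ℝ} (h : IsChirpPair hbar U S) (z : PhaseSpace n) :
    U * royerOp hbar z = royerOp hbar (sympEquiv S z) * U := by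
  obtain ⟨P, hP, hS, hU⟩ := h
  have hU' : ActsAs U _ id := hU
  have hz : sympEquiv S z =
      phasePoint (posPart z) (momPart z + Matrix.toEuclideanLin P (posPart z)) := by
    rw [sympEquiv_apply, hS, toEuclideanLin_fromBlocks]
    simp [add_comm]
  refine (hU'.mul (royerOp_actsAs hbar z) (Measure.QuasiMeasurePreserving.id _)).eq
    ((royerOp_actsAs hbar _).mul hU' (quasiMeasurePreserving_sub_left' _)) ?_ ?_
  · intro y
    rw [hz]
    simp only [royerPhase, posPart_phasePoint, momPart_phasePoint, id]
    rw [← Complex.exp_add, ← Complex.exp_add]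
    congr 1
    -- Symmetry of `P` merges the two cross terms of the quadratic phase at `2x - y`; the result is
    -- the momentum shift `Px`.
    have h1 : inner ℝ (Matrix.toEuclideanLin P y) (posPart z) =
        inner ℝ (Matrix.toEuclideanLin P (posPart z)) y := by
      rw [inner_toEuclideanLin, hP.eq, real_inner_comm]
    simp only [inner_add_left, inner_sub_right, inner_sub_left, map_sub, map_smul,
      real_inner_smul_left, real_inner_smul_right]
    rw [h1]
    push_cast
    ring
  · intro y
    rw [hz]
    simp

theorem rescaling_covariant {n : ℕ} (hbar : ℝ) {U : L2Space n ≃ₗᵢ[ℂ] L2Space n}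
    {S : Matrix.symplecticGroup (Fin n) ℝ} (h : IsRescalingPair U S) (z : PhaseSpace n) :
    U * royerOp hbar z = royerOp hbar (sympEquiv S z) * U := by
  obtain ⟨L, m, hm, hS, hU⟩ := h
  have hL : L.det ≠ 0 := by rcases hm with h | h <;> [exact h.1.ne'; exact h.1.ne]
  have hU' : ActsAs U _ _ := hU
  have hz : sympEquiv S z = phasePoint (Matrix.toEuclideanLin L⁻¹ (posPart z))
      (Matrix.toEuclideanLin L.transpose (momPart z)) := by
    rw [sympEquiv_apply, hS, toEuclideanLin_fromBlocks]
    simp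
  refine (hU'.mul (royerOp_actsAs hbar z) (quasiMeasurePreserving_toEuclideanLin hL)).eq
    ((royerOp_actsAs hbar _).mul hU' (quasiMeasurePreserving_sub_left' _)) ?_ ?_
  · intro y
    rw [hz]
    simp only [royerPhase, posPart_phasePoint, momPart_phasePoint]
    rw [mul_comm]
    congr 5
    rw [inner_toEuclideanLin, Matrix.transpose_transpose, map_sub,
      toEuclideanLin_injective_of_det_ne_zero hL]
  · intro y
    rw [hz]
    simp only [posPart_phasePoint, map_sub, map_smul, toEuclideanLin_injective_of_det_ne_zero hL]

theorem fourier_covariant {n : ℕ} {hbar : ℝ} {U : L2Space n ≃ₗᵢ[ℂ] L2Space n}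
    {S : Matrix.symplecticGroup (Fin n) ℝ} (h : IsFourierPair hbar U S) (z : PhaseSpace n) :
    U * royerOp hbar z = royerOp hbar (sympEquiv S z) * U := by
  obtain ⟨hS, hU⟩ := h
  have hz : sympEquiv S z = phasePoint (momPart z) (-posPart z) := by
    rw [sympEquiv_apply, hS, toEuclideanLin_fromBlocks]
    simp
  have hdense := SchwartzMap.denseRange_toLpCLM (E := EuclideanSpace ℝ (Fin n)) (F := ℂ)
    (μ := volume) (p := 2) ENNReal.ofNat_ne_top
  have hfun : (U * royerOp hbar z : L2Space n ≃ₗᵢ[ℂ] L2Space n) =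
      ((royerOp hbar (sympEquiv S z) * U : L2Space n ≃ₗᵢ[ℂ] L2Space n) : L2Space n → L2Space n) := by
    -- The integral formula for `U` is available only for integrable functions, so the identity is
    -- checked on Schwartz functions and extended by continuity.
    refine hdense.equalizer (LinearIsometryEquiv.continuous _) (LinearIsometryEquiv.continuous _) ?_
    ext1 f
    set ψ : L2Space n := SchwartzMap.toLpCLM ℂ ℂ 2 volume f with hψ
    have hint : Integrable (ψ : EuclideanSpace ℝ (Fin n) → ℂ) volume :=
      f.integrable.congr (SchwartzMap.coeFn_toLp f 2 volume).symm
    have hT := royerOp_actsAs hbar z ψ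
    have hint' : Integrable (royerOp hbar z ψ : EuclideanSpace ℝ (Fin n) → ℂ) volume := by
      refine Integrable.congr ?_ hT.symm
      refine (hint.comp_sub_left _).bdd_mul (c := 1)
        (continuous_royerPhase hbar z).aestronglyMeasurable ?_
      exact Filter.Eventually.of_forall fun _ => (Complex.norm_exp_ofReal_mul_I _).le
    change U (royerOp hbar z ψ) = royerOp hbar (sympEquiv S z) (U ψ)
    refine Lp.ext ((hU _ hint').trans ?_)
    refine Filter.EventuallyEq.trans ?_ (royerOp_actsAs hbar _ (U ψ)).symm
    filter_upwards [(quasiMeasurePreserving_sub_left' _).ae (hU ψ hint)] with x hx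
    rw [hx, mul_left_comm, hz]
    congr 1
    rw [← integral_const_mul]
    have e1 : ∫ x', Complex.exp (-(Complex.I / (hbar : ℂ)) * ((inner ℝ x x' : ℝ) : ℂ)) *
        royerOp hbar z ψ x' =
        ∫ x', Complex.exp (-(Complex.I / (hbar : ℂ)) * ((inner ℝ x x' : ℝ) : ℂ)) *
          (royerPhase hbar z x' * ψ ((2 : ℝ) • posPart z - x')) := by
      apply integral_congr_ae
      filter_upwards [hT] with y hy
      rw [hy]
    -- Reflecting the integration variable through the position part of `z` reduces the claim to an
    -- identity between exponents.
    rw [e1, ← integral_sub_left_eq_self _ volume ((2 : ℝ) • posPart z)]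
    congr 1
    ext1 y
    rw [sub_sub_cancel, ← mul_assoc, ← mul_assoc]
    congr 1
    simp only [royerPhase, posPart_phasePoint, momPart_phasePoint]
    rw [← Complex.exp_add, ← Complex.exp_add]
    congr 1
    simp only [inner_neg_left, inner_sub_right, inner_sub_left,
      real_inner_smul_left, real_inner_smul_right]
    rw [real_inner_comm (posPart z) x, real_inner_comm (posPart z) (momPart z)]
    push_cast
    ring
  exact LinearIsometryEquiv.ext fun ψ => congrFun hfun ψ

/-- The intertwining relation is stable under products and inverses, so the generators suffice. -/
theorem metaplectic_covariant {n : ℕ} {hbar : ℝ} {U : L2Space n ≃ₗᵢ[ℂ] L2Space n}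
    {S : Matrix.symplecticGroup (Fin n) ℝ} (h : MetaplecticCovers hbar U S) :
    ∀ z : PhaseSpace n, U * royerOp hbar z = royerOp hbar (sympEquiv S z) * U := by
  refine Subgroup.closure_induction
    (p := fun US _ => ∀ z, US.1 * royerOp hbar z = royerOp hbar (sympEquiv US.2 z) * US.1)
    ?_ ?_ ?_ ?_ h
  · rintro US (h | h | h) z
    · exact chirp_covariant h z
    · exact rescaling_covariant hbar h z
    · exact fourier_covariant h z
  · intro z
    simp [sympEquiv_apply]
  · intro A B _ _ hA hB z
    have : sympEquiv (A * B).2 z = sympEquiv A.2 (sympEquiv B.2 z) := by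
      simp [sympEquiv_apply]
    rw [this, Prod.fst_mul, mul_assoc, hB, ← mul_assoc, hA, mul_assoc]
  · intro A _ hA z
    have h1 : sympEquiv A.2 (sympEquiv (A⁻¹).2 z) = z := (sympEquiv A.2).apply_symm_apply z
    have h2 := hA (sympEquiv (A⁻¹).2 z)
    rw [h1] at h2
    rw [Prod.fst_inv, inv_mul_eq_iff_eq_mul, ← mul_assoc, h2, mul_inv_cancel_right]

/-- Symplectic covariance of the Wigner transform. -/
theorem wignerTransform_metaplectic {n : ℕ} {hbar : ℝ} (hpos : 0 < hbar)
    {U : L2Space n ≃ₗᵢ[ℂ] L2Space n} {S : Matrix.symplecticGroup (Fin n) ℝ}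
    (h : MetaplecticCovers hbar U S) (ψ : L2Space n) (z : PhaseSpace n) :
    wignerTransform hbar (U ψ) (sympEquiv S z) = wignerTransform hbar ψ z := by
  rw [wignerTransform_eq_inner hpos, wignerTransform_eq_inner hpos]
  have : royerOp hbar (sympEquiv S z) (U ψ) = U (royerOp hbar z ψ) :=
    congrArg (fun V : L2Space n ≃ₗᵢ[ℂ] L2Space n => V ψ) (metaplectic_covariant h z).symm
  rw [this, LinearIsometryEquiv.inner_map_map]

/-! ### Fourier integrals and the Fourier generator -/

open FourierTransform SchwartzMap in
/-- The Fourier transform on `L²` is given by the Fourier integral on `L¹ ∩ L²`. -/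
theorem fourier_L2_ae_eq_fourierIntegral {n : ℕ} (ψ : L2Space n)
    (hψ : Integrable (ψ : EuclideanSpace ℝ (Fin n) → ℂ) volume) :
    (𝓕 ψ : L2Space n) =ᵐ[volume] 𝓕 (ψ : EuclideanSpace ℝ (Fin n) → ℂ) := by
  have hcont : Continuous (𝓕 (ψ : EuclideanSpace ℝ (Fin n) → ℂ)) :=
    VectorFourier.fourierIntegral_continuous Real.continuous_fourierChar
      (by exact continuous_inner) hψ
  refine ae_eq_of_integral_contDiff_smul_eq
    ((Lp.memLp (𝓕 ψ)).locallyIntegrable (by norm_num)) hcont.locallyIntegrable ?_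
  intro g hg hgc
  have hg₁ : HasCompactSupport (Complex.ofRealCLM ∘ g) := hgc.comp_left rfl
  have hg₂ : ContDiff ℝ ((⊤ : ℕ∞) : WithTop ℕ∞) (Complex.ofRealCLM ∘ g) :=
    Complex.ofRealCLM.contDiff.comp hg
  let G : 𝓢(EuclideanSpace ℝ (Fin n), ℂ) := hg₁.toSchwartzMap hg₂
  have hG : ∀ x, G x = (g x : ℂ) := fun x => rfl
  -- On the `L²` side the transform moves to the test function through tempered distributions; on
  -- the integral side, in `h2`, through Fubini.
  have h1 := congrArg (fun T : 𝓢'(EuclideanSpace ℝ (Fin n), ℂ) => T G)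
    (Lp.fourier_toTemperedDistribution_eq ψ)
  simp only [TemperedDistribution.fourier_apply, Lp.toTemperedDistribution_apply] at h1
  have h2 : ∫ x, G x • 𝓕 (ψ : EuclideanSpace ℝ (Fin n) → ℂ) x = ∫ x, (𝓕 G) x • ψ x := by
    have := VectorFourier.integral_fourierIntegral_smul_eq_flip (L := innerₗ _)
      (μ := volume) (ν := volume) (f := G) (g := (ψ : EuclideanSpace ℝ (Fin n) → ℂ))
      Real.continuous_fourierChar continuous_inner G.integrable hψ
    rw [flip_innerₗ] at this
    exact this.symm
  have h3 : ∀ φ : EuclideanSpace ℝ (Fin n) → ℂ, ∫ x, g x • φ x = ∫ x, G x • φ x := fun φ => by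
    simp [hG]
  rw [h3, h3, h2, h1]

open FourierTransform in
/-- Injectivity of the Fourier transform on `L¹`. -/
theorem ae_eq_of_fourierIntegral_eq {n : ℕ} {f g : EuclideanSpace ℝ (Fin n) → ℂ}
    (hf : Integrable f volume) (hg : Integrable g volume) (h : ∀ ξ, 𝓕 f ξ = 𝓕 g ξ) :
    f =ᵐ[volume] g := by
  refine ae_eq_of_integral_contDiff_smul_eq hf.locallyIntegrable hg.locallyIntegrable ?_
  intro u hu huc
  have hu₁ : HasCompactSupport (Complex.ofRealCLM ∘ u) := huc.comp_left rfl
  have hu₂ : ContDiff ℝ ((⊤ : ℕ∞) : WithTop ℕ∞) (Complex.ofRealCLM ∘ u) :=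
    Complex.ofRealCLM.contDiff.comp hu
  let G : SchwartzMap (EuclideanSpace ℝ (Fin n)) ℂ := hu₁.toSchwartzMap hu₂
  have hG : ∀ x, G x = (u x : ℂ) := fun x => rfl
  have key : ∀ φ : EuclideanSpace ℝ (Fin n) → ℂ, Integrable φ volume →
      ∫ x, u x • φ x = ∫ x, (𝓕⁻ G : SchwartzMap (EuclideanSpace ℝ (Fin n)) ℂ) x • 𝓕 φ x := by
    intro φ hφ
    have := VectorFourier.integral_fourierIntegral_smul_eq_flip (L := innerₗ _)
      (μ := volume) (ν := volume) (f := (𝓕⁻ G : SchwartzMap (EuclideanSpace ℝ (Fin n)) ℂ)) (g := φ)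
      Real.continuous_fourierChar continuous_inner
      (𝓕⁻ G : SchwartzMap (EuclideanSpace ℝ (Fin n)) ℂ).integrable hφ
    rw [flip_innerₗ] at this
    refine Eq.trans ?_ this
    congr 1
    ext1 x
    have : VectorFourier.fourierIntegral Real.fourierChar volume (innerₗ _)
        (𝓕⁻ G : SchwartzMap (EuclideanSpace ℝ (Fin n)) ℂ) x = G x := by
      have h1 : 𝓕 (𝓕⁻ G) = G := FourierTransform.fourier_fourierInv_eq G
      exact congrArg (fun T : SchwartzMap (EuclideanSpace ℝ (Fin n)) ℂ => T x) h1
    rw [this, hG]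
    simp
  rw [key f hf, key g hg]
  simp only [h]

open FourierTransform in
lemma fourierIntegral_dilation {n : ℕ} {hbar : ℝ} (hpos : 0 < hbar)
    (f : EuclideanSpace ℝ (Fin n) → ℂ) (p : EuclideanSpace ℝ (Fin n)) :
    𝓕 f ((2 * Real.pi * hbar)⁻¹ • p) =
      ∫ y, Complex.exp (-(Complex.I / (hbar : ℂ)) * ((inner ℝ p y : ℝ) : ℂ)) * f y := by
  rw [Real.fourier_eq']
  congr 1
  ext1 y
  rw [smul_eq_mul]
  congr 2
  rw [real_inner_smul_right, real_inner_comm]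
  have h1 : (hbar : ℂ) ≠ 0 := by exact_mod_cast hpos.ne'
  have h2 : (Real.pi : ℂ) ≠ 0 := by exact_mod_cast Real.pi_ne_zero
  push_cast
  field_simp

lemma norm_fourier_const_sq (n : ℕ) {hbar : ℝ} (hpos : 0 < hbar) :
    ‖(1 / (2 * (Real.pi : ℂ) * Complex.I * (hbar : ℂ))) ^ ((n : ℂ) / 2)‖ ^ 2 =
      (2 * Real.pi * hbar)⁻¹ ^ n := by
  have h2 : ‖1 / (2 * (Real.pi : ℂ) * Complex.I * (hbar : ℂ))‖ = (2 * Real.pi * hbar)⁻¹ := by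
    simp [abs_of_pos hpos, abs_of_pos Real.pi_pos]
  have hbase : (1 / (2 * (Real.pi : ℂ) * Complex.I * (hbar : ℂ))) ≠ 0 := by
    rw [← norm_pos_iff, h2]
    positivity
  have h1 : ((n : ℂ) / 2) = (((n : ℝ) / 2 : ℝ) : ℂ) := by push_cast; rfl
  rw [h1, Complex.norm_cpow_of_ne_zero hbase, Complex.ofReal_re, Complex.ofReal_im,
    mul_zero, Real.exp_zero, div_one, h2, ← Real.rpow_natCast, ← Real.rpow_mul (by positivity),
    ← Real.rpow_natCast]
  congr 1
  push_cast
  ring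

/-- The unitary `L²` Fourier transform is followed by the dilation by `(2πħ)⁻¹`. Only the modulus of
`c` matters: `|c|²` is the Jacobian of that dilation. -/
lemma exists_dilated_fourier {n : ℕ} {hbar : ℝ} (hpos : 0 < hbar) {c : ℂ}
    (hnorm : ‖c‖ ^ 2 = (2 * Real.pi * hbar)⁻¹ ^ n) :
    ∃ U : L2Space n ≃ₗᵢ[ℂ] L2Space n, ∀ ψ : L2Space n,
      Integrable (⇑ψ) (volume : Measure (EuclideanSpace ℝ (Fin n))) →
      (U ψ : EuclideanSpace ℝ (Fin n) → ℂ) =ᵐ[volume] fun x =>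
        c * ∫ x' : EuclideanSpace ℝ (Fin n),
            Complex.exp (-(Complex.I / (hbar : ℂ)) * ((inner ℝ x x' : ℝ) : ℂ)) * ψ x' := by
  have hc : (2 * Real.pi * hbar)⁻¹ ≠ 0 := by positivity
  have hcpos : 0 < ‖c‖ := by
    have h2 : ‖c‖ ^ 2 ≠ 0 := by rw [hnorm]; positivity
    exact (norm_nonneg c).lt_of_ne' fun h0 => h2 (by rw [h0]; norm_num)
  have hmap : Measure.map (Homeomorph.smulOfNeZero (2 * Real.pi * hbar)⁻¹ hc)
      (volume : Measure (EuclideanSpace ℝ (Fin n))) = ENNReal.ofReal (‖c‖ ^ 2)⁻¹ • volume := by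
    have := Measure.map_addHaar_smul (volume : Measure (EuclideanSpace ℝ (Fin n))) hc
    rw [finrank_euclideanSpace_fin, abs_of_pos (by positivity), ← hnorm] at this
    exact this
  obtain ⟨V, hV⟩ := exists_actsAs (n := n) (Homeomorph.smulOfNeZero _ hc) (w := fun _ => c)
    continuous_const hcpos (fun _ => rfl) hmap
  refine ⟨(Lp.fourierTransformₗᵢ (EuclideanSpace ℝ (Fin n)) ℂ).trans V, fun ψ hψ => ?_⟩
  have hq : Measure.QuasiMeasurePreserving (fun x : EuclideanSpace ℝ (Fin n) =>
      (2 * Real.pi * hbar)⁻¹ • x) volume volume :=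
    Measure.quasiMeasurePreserving_smul _ hc
  have h1 := hV (Lp.fourierTransformₗᵢ (EuclideanSpace ℝ (Fin n)) ℂ ψ)
  have h2 := hq.ae (fourier_L2_ae_eq_fourierIntegral ψ hψ)
  filter_upwards [h1, h2] with x hx1 hx2
  rw [← fourierIntegral_dilation hpos, ← hx2]
  exact hx1

theorem exists_fourier {n : ℕ} {hbar : ℝ} (hpos : 0 < hbar) :
    ∃ U : L2Space n ≃ₗᵢ[ℂ] L2Space n, ∀ ψ : L2Space n,
      Integrable (⇑ψ) (volume : Measure (EuclideanSpace ℝ (Fin n))) →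
      (U ψ : EuclideanSpace ℝ (Fin n) → ℂ) =ᵐ[volume] fun x =>
        (1 / (2 * (Real.pi : ℂ) * Complex.I * (hbar : ℂ))) ^ ((n : ℂ) / 2) *
          ∫ x' : EuclideanSpace ℝ (Fin n),
            Complex.exp (-(Complex.I / (hbar : ℂ)) * ((inner ℝ x x' : ℝ) : ℂ)) * ψ x' :=
  exists_dilated_fourier hpos (norm_fourier_const_sq n hpos)

/-! ### A state is determined up to a phase by its Wigner transform -/

lemma integrable_wigner_kernel {n : ℕ} (ψ : L2Space n) (x : EuclideanSpace ℝ (Fin n)) :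
    Integrable (fun y : EuclideanSpace ℝ (Fin n) => ψ (x + (1 / 2 : ℝ) • y) *
      (starRingEnd ℂ) (ψ (x - (1 / 2 : ℝ) • y))) volume := by
  have h : Integrable (fun a : EuclideanSpace ℝ (Fin n) =>
      ψ a * starRingEnd ℂ (ψ ((2 : ℝ) • x - a))) volume := by
    have h1 : MemLp (fun a : EuclideanSpace ℝ (Fin n) =>
        starRingEnd ℂ (ψ ((2 : ℝ) • x - a))) 2 volume :=
      ((Lp.memLp ψ).comp_measurePreserving
        (Measure.measurePreserving_sub_left volume ((2 : ℝ) • x))).star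
    exact (Lp.memLp ψ).integrable_mul h1
  have h2 := (h.comp_add_left x).comp_smul (R := (1 / 2 : ℝ)) (by norm_num)
  refine h2.congr (Filter.Eventually.of_forall fun y => ?_)
  simp only
  congr 3
  rw [two_smul]
  abel_nf

/-- For fixed `x`, the function `p ↦ Wψ(x, p)` is, up to scaling, the Fourier transform of the
kernel in `y`, which is integrable as a product of `L²` functions; injectivity on `L¹` applies. -/
theorem kernel_ae_eq_of_wignerTransform_eq {n : ℕ} {hbar : ℝ} (hpos : 0 < hbar) {ψ φ : L2Space n}
    (h : ∀ z, wignerTransform hbar ψ z = wignerTransform hbar φ z)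
    (x : EuclideanSpace ℝ (Fin n)) :
    (fun y : EuclideanSpace ℝ (Fin n) => ψ (x + (1 / 2 : ℝ) • y) *
      (starRingEnd ℂ) (ψ (x - (1 / 2 : ℝ) • y))) =ᵐ[volume] fun y => φ (x + (1 / 2 : ℝ) • y) *
      (starRingEnd ℂ) (φ (x - (1 / 2 : ℝ) • y)) := by
  refine ae_eq_of_fourierIntegral_eq (integrable_wigner_kernel ψ x)
    (integrable_wigner_kernel φ x) fun ξ => ?_
  have hξ : ξ = (2 * Real.pi * hbar)⁻¹ • ((2 * Real.pi * hbar) • ξ) := by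
    rw [smul_smul, inv_mul_cancel₀ (by positivity), one_smul]
  rw [hξ, fourierIntegral_dilation hpos, fourierIntegral_dilation hpos]
  have h1 := h (phasePoint x ((2 * Real.pi * hbar) • ξ))
  simp only [wignerTransform, posPart_phasePoint, momPart_phasePoint] at h1
  refine mul_left_cancel₀ (pow_ne_zero n (one_div_ne_zero ?_)) h1
  exact_mod_cast (by positivity : 2 * Real.pi * hbar ≠ 0)

lemma quasiMeasurePreserving_dilation {n : ℕ} (x : EuclideanSpace ℝ (Fin n)) :
    Measure.QuasiMeasurePreserving (fun a : EuclideanSpace ℝ (Fin n) => (2 : ℝ) • (a - x))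
      volume volume :=
  (Measure.quasiMeasurePreserving_smul volume (two_ne_zero (α := ℝ))).comp
    (measurePreserving_sub_right volume x).quasiMeasurePreserving

theorem tensor_ae_eq_of_wignerTransform_eq {n : ℕ} {hbar : ℝ} (hpos : 0 < hbar) {ψ φ : L2Space n}
    (h : ∀ z, wignerTransform hbar ψ z = wignerTransform hbar φ z) :
    ∀ᵐ a : EuclideanSpace ℝ (Fin n), ∀ᵐ b : EuclideanSpace ℝ (Fin n),
      ψ a * (starRingEnd ℂ) (ψ b) = φ a * (starRingEnd ℂ) (φ b) := by
  have h1 : ∀ x : EuclideanSpace ℝ (Fin n), ∀ᵐ a : EuclideanSpace ℝ (Fin n),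
      ψ a * (starRingEnd ℂ) (ψ ((2 : ℝ) • x - a)) =
        φ a * (starRingEnd ℂ) (φ ((2 : ℝ) • x - a)) := by
    intro x
    -- Here `y = 2(a - x)`, so `x + y/2 = a` and `x - y/2 = 2x - a`.
    filter_upwards [(quasiMeasurePreserving_dilation x).ae
      (kernel_ae_eq_of_wignerTransform_eq hpos h x)] with a ha
    have e1 : x + (1 / 2 : ℝ) • ((2 : ℝ) • (a - x)) = a := by
      rw [smul_smul]; norm_num
    have e2 : x - (1 / 2 : ℝ) • ((2 : ℝ) • (a - x)) = (2 : ℝ) • x - a := by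
      rw [smul_smul, two_smul]; norm_num; abel
    simpa only [e1, e2] using ha
  have hmψ : Measurable (ψ : EuclideanSpace ℝ (Fin n) → ℂ) := (Lp.stronglyMeasurable ψ).measurable
  have hmφ : Measurable (φ : EuclideanSpace ℝ (Fin n) → ℂ) := (Lp.stronglyMeasurable φ).measurable
  -- Fubini exchanges the quantifiers. With `a` fixed, `b = 2x - a` becomes a free variable, and
  -- null sets in `x` are null in `b`.
  have h2 : ∀ᵐ a : EuclideanSpace ℝ (Fin n), ∀ᵐ x : EuclideanSpace ℝ (Fin n),
      ψ a * (starRingEnd ℂ) (ψ ((2 : ℝ) • x - a)) =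
        φ a * (starRingEnd ℂ) (φ ((2 : ℝ) • x - a)) := by
    refine (Measure.ae_ae_comm ?_).1 (Filter.Eventually.of_forall h1)
    refine measurableSet_eq_fun ?_ ?_
    · exact (hmψ.comp measurable_snd).mul (Complex.continuous_conj.measurable.comp
        (hmψ.comp ((measurable_fst.const_smul (2 : ℝ)).sub measurable_snd)))
    · exact (hmφ.comp measurable_snd).mul (Complex.continuous_conj.measurable.comp
        (hmφ.comp ((measurable_fst.const_smul (2 : ℝ)).sub measurable_snd)))
  filter_upwards [h2] with a ha
  have hq : Measure.QuasiMeasurePreserving (fun b : EuclideanSpace ℝ (Fin n) =>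
      (1 / 2 : ℝ) • (b + a)) volume volume :=
    (Measure.quasiMeasurePreserving_smul volume (by norm_num : (1 / 2 : ℝ) ≠ 0)).comp
      (measurePreserving_add_right volume a).quasiMeasurePreserving
  filter_upwards [hq.ae ha] with b hb
  have e : (2 : ℝ) • (1 / 2 : ℝ) • (b + a) - a = b := by
    rw [smul_smul]; norm_num
  simpa only [e] using hb

/-- Two states with the same Wigner transform differ by a phase. -/
theorem eq_phase_smul_of_wignerTransform_eq {n : ℕ} {hbar : ℝ} (hpos : 0 < hbar)
    {ψ φ : L2Space n} (hφ : φ ≠ 0)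
    (h : ∀ z, wignerTransform hbar ψ z = wignerTransform hbar φ z) :
    ∃ c : ℂ, ‖c‖ = 1 ∧ ψ = c • φ := by
  have h1 := tensor_ae_eq_of_wignerTransform_eq hpos h
  have h2 : ∃ᵐ a : EuclideanSpace ℝ (Fin n), φ a ≠ 0 := by
    intro h0
    apply hφ
    rw [Lp.eq_zero_iff_ae_eq_zero]
    filter_upwards [h0] with a ha
    simpa using ha
  obtain ⟨a, ha0, ha⟩ := (h2.and_eventually h1).exists
  -- If `ψ a` vanished, the tensor identity would make `φ` vanish almost everywhere.
  have hconj : ψ a ≠ 0 := by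
    intro h0
    apply hφ
    rw [Lp.eq_zero_iff_ae_eq_zero]
    filter_upwards [ha] with b hb
    rw [h0, zero_mul, eq_comm, mul_eq_zero] at hb
    simpa [ha0] using hb
  let c : ℂ := starRingEnd ℂ (φ a) / starRingEnd ℂ (ψ a)
  have hψ : ∀ᵐ b, ψ b = c * φ b := by
    filter_upwards [ha] with b hb
    have := congrArg (starRingEnd ℂ) hb
    simp only [map_mul, Complex.conj_conj] at this
    have h3 : starRingEnd ℂ (ψ a) ≠ 0 := by simpa using hconj
    simp only [c]
    field_simp
    linear_combination this
  refine ⟨c, ?_, Lp.ext ?_⟩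
  · obtain ⟨a', ha'0, ha', hψa'⟩ := (h2.and_eventually (h1.and hψ)).exists
    obtain ⟨b, hb0, hb, hψb⟩ := (h2.and_eventually (ha'.and hψ)).exists
    rw [hψa', hψb, map_mul] at hb
    have h4 : c * starRingEnd ℂ c = 1 := by
      have h5 : φ a' * starRingEnd ℂ (φ b) ≠ 0 := by simp [ha'0, hb0]
      apply mul_right_cancel₀ h5
      linear_combination hb
    rw [Complex.mul_conj, Complex.normSq_eq_norm_sq] at h4
    have h6 : ‖c‖ ^ 2 = 1 := by exact_mod_cast h4
    exact (pow_eq_one_iff_of_nonneg (norm_nonneg _) two_ne_zero).1 h6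
  · filter_upwards [hψ, Lp.coeFn_smul c φ] with b hb hb'
    rw [hb, hb', Pi.smul_apply, smul_eq_mul]

lemma wignerTransform_phase_smul {n : ℕ} {hbar : ℝ} (hpos : 0 < hbar) {c : ℂ} (hc : ‖c‖ = 1)
    (ψ : L2Space n) (z : PhaseSpace n) :
    wignerTransform hbar (c • ψ : L2Space n) z = wignerTransform hbar ψ z := by
  rw [wignerTransform_eq_inner hpos, wignerTransform_eq_inner hpos, map_smul, inner_smul_left,
    inner_smul_right, ← mul_assoc (starRingEnd ℂ c), mul_comm (starRingEnd ℂ c), Complex.mul_conj,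
    Complex.normSq_eq_norm_sq, hc]
  simp

lemma norm_I_cpow_ofReal (γ : ℝ) : ‖Complex.I ^ (γ : ℂ)‖ = 1 := by
  rw [Complex.norm_cpow_of_ne_zero Complex.I_ne_zero]
  simp

/-- Since `i^γ = e^{iπγ/2}`, real powers of `i` fill the whole unit circle. -/
lemma exists_I_cpow_eq {c : ℂ} (hc : ‖c‖ = 1) : ∃ γ : ℝ, c = Complex.I ^ (γ : ℂ) := by
  refine ⟨c.arg / (Real.pi / 2), ?_⟩
  rw [Complex.cpow_def_of_ne_zero Complex.I_ne_zero, Complex.log_I]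
  have h1 := Complex.norm_mul_exp_arg_mul_I c
  rw [hc, Complex.ofReal_one, one_mul] at h1
  conv_lhs => rw [← h1]
  congr 1
  have : (Real.pi : ℂ) ≠ 0 := by exact_mod_cast Real.pi_ne_zero
  push_cast
  field_simp

/-! ### Existence of the generators of the metaplectic group -/

theorem exists_isChirpPair {n : ℕ} (hbar : ℝ) {P : Matrix (Fin n) (Fin n) ℝ} (hP : P.IsSymm)
    {S : Matrix.symplecticGroup (Fin n) ℝ} (hS : S.1 = Matrix.fromBlocks 1 0 P 1) :
    ∃ U, IsChirpPair hbar U S ∧ ActsAs U (fun x => Complex.exp (Complex.I / (2 * (hbar : ℂ)) *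
        ((inner ℝ (Matrix.toEuclideanLin P x) x : ℝ) : ℂ))) id := by
  have hcont : Continuous fun x : EuclideanSpace ℝ (Fin n) => Complex.exp
      (Complex.I / (2 * (hbar : ℂ)) * ((inner ℝ (Matrix.toEuclideanLin P x) x : ℝ) : ℂ)) := by
    have : Continuous (Matrix.toEuclideanLin P) := LinearMap.continuous_of_finiteDimensional _
    fun_prop
  have hnorm : ∀ x : EuclideanSpace ℝ (Fin n), ‖Complex.exp
      (Complex.I / (2 * (hbar : ℂ)) * ((inner ℝ (Matrix.toEuclideanLin P x) x : ℝ) : ℂ))‖ = 1 := by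
    intro x
    rw [← Complex.norm_exp_ofReal_mul_I (inner ℝ (Matrix.toEuclideanLin P x) x / (2 * hbar))]
    congr 2
    push_cast
    ring
  obtain ⟨U, hU⟩ := exists_actsAs (Homeomorph.refl _) hcont one_pos hnorm (by
    simp [Homeomorph.refl])
  exact ⟨U, ⟨P, hP, hS, hU⟩, hU⟩

theorem exists_isRescalingPair {n : ℕ} {L : Matrix (Fin n) (Fin n) ℝ} (hL : L.det ≠ 0)
    {S : Matrix.symplecticGroup (Fin n) ℝ}
    (hS : S.1 = Matrix.fromBlocks L⁻¹ 0 0 L.transpose) :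
    ∃ U, IsRescalingPair U S ∧ ∃ m : ℤ, ActsAs U
      (fun _ => Complex.I ^ m * ((Real.sqrt |L.det| : ℝ) : ℂ)) (Matrix.toEuclideanLin L) := by
  obtain ⟨m, hm⟩ : ∃ m : ℤ, (0 < L.det ∧ Even m) ∨ (L.det < 0 ∧ Odd m) := by
    rcases lt_or_gt_of_ne hL with h | h
    · exact ⟨1, Or.inr ⟨h, odd_one⟩⟩
    · exact ⟨0, Or.inl ⟨h, Even.zero⟩⟩
  have hdet : LinearMap.det (Matrix.toEuclideanLin L) ≠ 0 := by rwa [det_toEuclideanLin]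
  let e := ((Matrix.toEuclideanLin L).equivOfDetNeZero hdet).toContinuousLinearEquiv.toHomeomorph
  have he : Measure.map e volume =
      ENNReal.ofReal (Real.sqrt |L.det| ^ 2)⁻¹ • volume := by
    rw [Real.sq_sqrt (abs_nonneg _), ← abs_inv, ← det_toEuclideanLin]
    exact Measure.map_linearMap_addHaar_eq_smul_addHaar volume hdet
  obtain ⟨U, hU⟩ := exists_actsAs (n := n) e
    (w := fun _ => Complex.I ^ m * ((Real.sqrt |L.det| : ℝ) : ℂ)) continuous_const
    (Real.sqrt_pos.2 (abs_pos.2 hL)) (fun _ => by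
      rw [norm_mul, norm_zpow, Complex.norm_I, one_zpow, one_mul, Complex.norm_real,
        Real.norm_of_nonneg (Real.sqrt_nonneg _)]) he
  exact ⟨U, ⟨L, m, hm, hS, hU⟩, m, hU⟩

/-! ### The metaplectic projection is onto -/

lemma covers_mul {n : ℕ} {hbar : ℝ} {U V : L2Space n ≃ₗᵢ[ℂ] L2Space n}
    {S R : Matrix.symplecticGroup (Fin n) ℝ} (hU : MetaplecticCovers hbar U S)
    (hV : MetaplecticCovers hbar V R) : MetaplecticCovers hbar (U * V) (S * R) :=
  (metaplecticGraph n hbar).mul_mem hU hV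

lemma IsChirpPair.covers {n : ℕ} {hbar : ℝ} {U : L2Space n ≃ₗᵢ[ℂ] L2Space n}
    {S : Matrix.symplecticGroup (Fin n) ℝ} (h : IsChirpPair hbar U S) :
    MetaplecticCovers hbar U S := Subgroup.subset_closure (Or.inl h)

lemma IsRescalingPair.covers {n : ℕ} (hbar : ℝ) {U : L2Space n ≃ₗᵢ[ℂ] L2Space n}
    {S : Matrix.symplecticGroup (Fin n) ℝ} (h : IsRescalingPair U S) :
    MetaplecticCovers hbar U S := Subgroup.subset_closure (Or.inr (Or.inl h))

/-- The image of the metaplectic projection. -/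
def coveredSubgroup (n : ℕ) (hbar : ℝ) : Subgroup (Matrix.symplecticGroup (Fin n) ℝ) :=
  (metaplecticGraph n hbar).map (MonoidHom.snd _ _)

lemma mem_coveredSubgroup {n : ℕ} {hbar : ℝ} {S : Matrix.symplecticGroup (Fin n) ℝ} :
    S ∈ coveredSubgroup n hbar ↔ ∃ U, MetaplecticCovers hbar U S := by
  constructor
  · rintro ⟨⟨U, _⟩, h, rfl⟩
    exact ⟨U, h⟩
  · rintro ⟨U, h⟩
    exact ⟨(U, S), h, rfl⟩

lemma lower_mem_symplecticGroup {n : ℕ} {P : Matrix (Fin n) (Fin n) ℝ} (hP : P.IsSymm) :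
    Matrix.fromBlocks 1 0 P 1 ∈ Matrix.symplecticGroup (Fin n) ℝ := by
  rw [SymplecticGroup.fromBlocks_mem_iff]
  simp [hP.eq]

lemma diag_mem_symplecticGroup {n : ℕ} {L : Matrix (Fin n) (Fin n) ℝ} (hL : L.det ≠ 0) :
    Matrix.fromBlocks L⁻¹ 0 0 L.transpose ∈ Matrix.symplecticGroup (Fin n) ℝ := by
  rw [SymplecticGroup.fromBlocks_mem_iff]
  simp [← Matrix.transpose_mul, Matrix.mul_nonsing_inv _ (isUnit_iff_ne_zero.2 hL)]

lemma rotation_mem_symplecticGroup (n : ℕ) :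
    Matrix.fromBlocks 0 1 (-1) 0 ∈ Matrix.symplecticGroup (Fin n) ℝ := by
  rw [SymplecticGroup.fromBlocks_mem_iff]
  simp

lemma lower_mem_covered {n : ℕ} (hbar : ℝ) {P : Matrix (Fin n) (Fin n) ℝ} (hP : P.IsSymm) :
    ⟨_, lower_mem_symplecticGroup hP⟩ ∈ coveredSubgroup n hbar :=
  mem_coveredSubgroup.2 <| by
    obtain ⟨U, hU, _⟩ := exists_isChirpPair hbar hP
      (S := ⟨_, lower_mem_symplecticGroup hP⟩) rfl
    exact ⟨U, hU.covers⟩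

lemma diag_mem_covered {n : ℕ} (hbar : ℝ) {L : Matrix (Fin n) (Fin n) ℝ} (hL : L.det ≠ 0) :
    ⟨_, diag_mem_symplecticGroup hL⟩ ∈ coveredSubgroup n hbar :=
  mem_coveredSubgroup.2 <| by
    obtain ⟨U, hU, _⟩ := exists_isRescalingPair hL
      (S := ⟨_, diag_mem_symplecticGroup hL⟩) rfl
    exact ⟨U, hU.covers hbar⟩

lemma rotation_mem_covered (n : ℕ) {hbar : ℝ} (hpos : 0 < hbar) :
    ⟨_, rotation_mem_symplecticGroup n⟩ ∈ coveredSubgroup n hbar :=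
  mem_coveredSubgroup.2 <| by
    obtain ⟨U, hU⟩ := exists_fourier (n := n) hpos
    exact ⟨U, Subgroup.subset_closure (Or.inr (Or.inr ⟨rfl, hU⟩))⟩

/-- An upper shear is the conjugate by `J` of the lower shear with parameter `-Q`. -/
lemma upper_mem_covered {n : ℕ} {hbar : ℝ} (hpos : 0 < hbar) {Q : Matrix (Fin n) (Fin n) ℝ}
    (hQ : Q.IsSymm) {S : Matrix.symplecticGroup (Fin n) ℝ}
    (hS : S.1 = Matrix.fromBlocks 1 Q 0 1) : S ∈ coveredSubgroup n hbar := by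
  have hQ' : (-Q).IsSymm := hQ.neg
  have h : S * ⟨_, rotation_mem_symplecticGroup n⟩ =
      ⟨_, rotation_mem_symplecticGroup n⟩ * ⟨_, lower_mem_symplecticGroup hQ'⟩ := by
    apply Subtype.ext
    simp [hS, Matrix.fromBlocks_multiply]
  rw [eq_mul_inv_of_mul_eq h]
  exact mul_mem (mul_mem (rotation_mem_covered n hpos) (lower_mem_covered hbar hQ'))
    (inv_mem (rotation_mem_covered n hpos))

lemma symplectic_row_relation {n : ℕ} {A B C D : Matrix (Fin n) (Fin n) ℝ}
    (h : Matrix.fromBlocks A B C D ∈ Matrix.symplecticGroup (Fin n) ℝ) :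
    A * B.transpose = B * A.transpose := by
  have h2 := SymplecticGroup.transpose_mem h
  rw [Matrix.fromBlocks_transpose, SymplecticGroup.fromBlocks_mem_iff] at h2
  simpa using h2.1

/-- Block elimination: lower shear by `CA⁻¹`, rescaling with `L = A⁻¹`, upper shear by `A⁻¹B`. The
symplectic relations make both shear parameters symmetric and determine `D`. -/
lemma covered_of_det_ne_zero {n : ℕ} {hbar : ℝ} (hpos : 0 < hbar)
    {A B C D : Matrix (Fin n) (Fin n) ℝ} (hA : A.det ≠ 0)
    {S : Matrix.symplecticGroup (Fin n) ℝ} (hS : S.1 = Matrix.fromBlocks A B C D) :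
    S ∈ coveredSubgroup n hbar := by
  have hu : IsUnit A.det := isUnit_iff_ne_zero.2 hA
  have hut : IsUnit A.transpose.det := by rwa [Matrix.det_transpose]
  have hmem : Matrix.fromBlocks A B C D ∈ Matrix.symplecticGroup (Fin n) ℝ := hS ▸ S.2
  have hrow := symplectic_row_relation hmem
  obtain ⟨h1, -, h3⟩ := SymplecticGroup.fromBlocks_mem_iff.1 hmem
  have hP : (C * A⁻¹).IsSymm := by
    rw [Matrix.IsSymm, Matrix.transpose_mul, Matrix.transpose_nonsing_inv]
    calc A.transpose⁻¹ * C.transpose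
        = A.transpose⁻¹ * (C.transpose * A) * A⁻¹ := by
          rw [mul_assoc, mul_assoc, Matrix.mul_nonsing_inv _ hu, mul_one]
      _ = C * A⁻¹ := by
          rw [← h1, ← mul_assoc, Matrix.nonsing_inv_mul _ hut, one_mul]
  have hQ : (A⁻¹ * B).IsSymm := by
    rw [Matrix.IsSymm, Matrix.transpose_mul, Matrix.transpose_nonsing_inv]
    calc B.transpose * A.transpose⁻¹
        = A⁻¹ * (A * B.transpose) * A.transpose⁻¹ := by
          rw [← mul_assoc, Matrix.nonsing_inv_mul _ hu, one_mul]
      _ = A⁻¹ * B := by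
          rw [hrow, mul_assoc, mul_assoc, Matrix.mul_nonsing_inv _ hut, mul_one]
  have hD : D = C * A⁻¹ * B + A.transpose⁻¹ := by
    calc D = A.transpose⁻¹ * (A.transpose * D) := by
          rw [← mul_assoc, Matrix.nonsing_inv_mul _ hut, one_mul]
      _ = A.transpose⁻¹ * (C.transpose * B + 1) := by rw [← h3]; congr 1; abel
      _ = (C * A⁻¹).transpose * B + A.transpose⁻¹ := by
          rw [Matrix.transpose_mul, Matrix.transpose_nonsing_inv, mul_add, mul_one, mul_assoc]
      _ = _ := by rw [hP.eq]
  have hL : A⁻¹.det ≠ 0 := by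
    rw [Matrix.det_nonsing_inv, Ring.inverse_eq_inv']; exact inv_ne_zero hA
  have hup : Matrix.fromBlocks 1 (A⁻¹ * B) 0 1 ∈ Matrix.symplecticGroup (Fin n) ℝ := by
    rw [SymplecticGroup.fromBlocks_mem_iff]
    simp only [Matrix.transpose_one, Matrix.transpose_zero, mul_zero, zero_mul, mul_one, one_mul,
      sub_zero, true_and, and_true]
    exact hQ.eq
  have hfac : S = ⟨_, lower_mem_symplecticGroup hP⟩ * ⟨_, diag_mem_symplecticGroup hL⟩ *
      ⟨_, hup⟩ := by
    apply Subtype.ext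
    simp only [Submonoid.coe_mul, hS, Matrix.fromBlocks_multiply, Matrix.nonsing_inv_nonsing_inv _ hu,
      Matrix.transpose_nonsing_inv]
    simp only [one_mul, mul_zero, add_zero, zero_mul, zero_add, mul_one]
    rw [← mul_assoc A, Matrix.mul_nonsing_inv _ hu, one_mul, mul_assoc C,
      Matrix.nonsing_inv_mul _ hu, mul_one, ← mul_assoc, hD]
  rw [hfac]
  exact mul_mem (mul_mem (lower_mem_covered hbar hP) (diag_mem_covered hbar hL))
    (upper_mem_covered hpos hQ rfl)

lemma posDef_mul_transpose {n : ℕ} (S : Matrix.symplecticGroup (Fin n) ℝ) :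
    (S.1 * S.1.transpose).PosDef := by
  have hu : IsUnit S.1 := by
    rw [Matrix.isUnit_iff_isUnit_det]
    exact SymplecticGroup.symplectic_det S.2
  have := Matrix.PosDef.mul_conjTranspose_self S.1 (Matrix.vecMul_injective_of_isUnit hu)
  rwa [Matrix.conjTranspose_eq_transpose_of_trivial] at this

lemma posDef_toBlocks₁₁ {n : ℕ} {G : Matrix (Fin n ⊕ Fin n) (Fin n ⊕ Fin n) ℝ} (hG : G.PosDef) :
    G.toBlocks₁₁.PosDef :=
  hG.submatrix Sum.inl_injective

/-- If `det (A + tB)` vanished for all real `t`, this polynomial would also vanish at `t = i`. But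
the commutation hypothesis gives `(A + iB)(A - iB)ᵀ = AAᵀ + BBᵀ`, which is invertible. -/
lemma exists_det_add_smul_ne_zero {n : ℕ} {A B : Matrix (Fin n) (Fin n) ℝ}
    (hAB : A * B.transpose = B * A.transpose)
    (hdet : (A * A.transpose + B * B.transpose).det ≠ 0) : ∃ t : ℝ, (A + t • B).det ≠ 0 := by
  by_contra! h
  let M : Matrix (Fin n) (Fin n) (Polynomial ℝ) :=
    A.map Polynomial.C + (Polynomial.X : Polynomial ℝ) • B.map Polynomial.C
  have hM : ∀ {R : Type} [CommRing R] (f : ℝ →+* R) (r : R),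
      (Polynomial.eval₂RingHom f r) M.det = (A.map f + r • B.map f).det := by
    intro R _ f r
    rw [RingHom.map_det]
    congr 1
    ext i j
    simp [M]
    ring
  have hp : M.det = 0 := by
    apply Polynomial.funext
    intro t
    have := hM (RingHom.id ℝ) t
    rw [Polynomial.eval_zero]
    refine this.trans ?_
    simpa using h t
  have h1 := hM Complex.ofRealHom Complex.I
  rw [hp, map_zero] at h1
  have h2 : (A.map Complex.ofRealHom + Complex.I • B.map Complex.ofRealHom) *
      (A.map Complex.ofRealHom - Complex.I • B.map Complex.ofRealHom).transpose =
      (A * A.transpose + B * B.transpose).map Complex.ofRealHom := by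
    have e := congrArg (fun N : Matrix (Fin n) (Fin n) ℝ => N.map Complex.ofRealHom) hAB
    simp only [Matrix.map_mul, Matrix.transpose_map] at e
    rw [Matrix.map_add _ (map_add _), Matrix.map_mul, Matrix.map_mul, Matrix.transpose_sub,
      Matrix.transpose_smul, mul_sub, add_mul, add_mul, mul_smul_comm, mul_smul_comm,
      smul_mul_assoc, smul_mul_assoc, smul_smul, Complex.I_mul_I, Matrix.transpose_map,
      Matrix.transpose_map, ← e]
    simp only [neg_smul, one_smul]
    abel
  have h3 := congrArg Matrix.det h2
  rw [Matrix.det_mul, ← h1, zero_mul] at h3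
  have h4 : Complex.ofRealHom (A * A.transpose + B * B.transpose).det =
      ((A * A.transpose + B * B.transpose).map Complex.ofRealHom).det := RingHom.map_det _ _
  rw [← h3] at h4
  exact hdet (by simpa using h4)

/-- `AAᵀ + BBᵀ` is the upper-left block of `SSᵀ`, hence positive definite. Right multiplication by
the lower shear `tI` replaces `A` by `A + tB`, which is invertible for a suitable `t`. -/
theorem coveredSubgroup_eq_top (n : ℕ) {hbar : ℝ} (hpos : 0 < hbar) :
    coveredSubgroup n hbar = ⊤ := by
  rw [eq_top_iff]
  rintro S -
  obtain ⟨A, B, C, D, hS⟩ : ∃ A B C D, S.1 = Matrix.fromBlocks A B C D :=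
    ⟨_, _, _, _, (Matrix.fromBlocks_toBlocks S.1).symm⟩
  have hmem : Matrix.fromBlocks A B C D ∈ Matrix.symplecticGroup (Fin n) ℝ := hS ▸ S.2
  have hdet : (A * A.transpose + B * B.transpose).det ≠ 0 := by
    have h := (posDef_toBlocks₁₁ (posDef_mul_transpose S)).det_pos.ne'
    rwa [hS, Matrix.fromBlocks_transpose, Matrix.fromBlocks_multiply,
      Matrix.toBlocks_fromBlocks₁₁] at h
  obtain ⟨t, ht⟩ := exists_det_add_smul_ne_zero (symplectic_row_relation hmem) hdet
  have hsym : (t • (1 : Matrix (Fin n) (Fin n) ℝ)).IsSymm := Matrix.isSymm_one.smul t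
  have h1 : S * ⟨_, lower_mem_symplecticGroup hsym⟩ ∈ coveredSubgroup n hbar := by
    refine covered_of_det_ne_zero hpos (A := A + t • B) (B := B) (C := C + t • D) (D := D) ht ?_
    simp [hS, Matrix.fromBlocks_multiply]
  exact (mul_mem_cancel_right (lower_mem_covered hbar hsym)).1 h1

theorem exists_metaplecticCovers {n : ℕ} {hbar : ℝ} (hpos : 0 < hbar)
    (S : Matrix.symplecticGroup (Fin n) ℝ) : ∃ U, MetaplecticCovers hbar U S := by
  rw [← mem_coveredSubgroup, coveredSubgroup_eq_top n hpos]
  trivial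

/-! ### Pre-Iwasawa decomposition -/

/-- The symplectic positive matrix of the generalized Gaussian with parameters `(X, Y)`. -/
def gaussianGram {n : ℕ} (X Y : Matrix (Fin n) (Fin n) ℝ) :
    Matrix (Fin n ⊕ Fin n) (Fin n ⊕ Fin n) ℝ :=
  Matrix.fromBlocks X⁻¹ (-(X⁻¹ * Y)) (-(Y * X⁻¹)) (Y * X⁻¹ * Y + X)

lemma gaussianGram_injective {n : ℕ} {X Y X' Y' : Matrix (Fin n) (Fin n) ℝ} (hX : X.PosDef)
    (hX' : X'.PosDef) (h : gaussianGram X Y = gaussianGram X' Y') : X = X' ∧ Y = Y' := by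
  have hu : IsUnit X.det := isUnit_iff_ne_zero.2 hX.det_pos.ne'
  have hu' : IsUnit X'.det := isUnit_iff_ne_zero.2 hX'.det_pos.ne'
  obtain ⟨h1, h2, -, -⟩ := Matrix.fromBlocks_inj.1 h
  have hXX : X = X' := by
    rw [← Matrix.nonsing_inv_nonsing_inv X hu, h1, Matrix.nonsing_inv_nonsing_inv X' hu']
  subst hXX
  refine ⟨rfl, ?_⟩
  have h3 := congrArg (X * ·) (neg_injective h2)
  simpa only [← mul_assoc, Matrix.mul_nonsing_inv _ hu, one_mul] using h3

/-- `SSᵀ` is both symmetric and symplectic, so its blocks `a, b` determine the others. Matching the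
first row forces `X = a⁻¹` and `Y = -a⁻¹b`. -/
theorem exists_gaussianGram_eq {n : ℕ} (S : Matrix.symplecticGroup (Fin n) ℝ) :
    ∃ X Y : Matrix (Fin n) (Fin n) ℝ, X.PosDef ∧ Y.IsSymm ∧
      gaussianGram X Y = S.1 * S.1.transpose := by
  have hG := posDef_mul_transpose S
  have hmem : S.1 * S.1.transpose ∈ Matrix.symplecticGroup (Fin n) ℝ :=
    mul_mem S.2 (SymplecticGroup.transpose_mem S.2)
  generalize hGdef : S.1 * S.1.transpose = G at hG hmem
  obtain ⟨a, b, c, d, rfl⟩ : ∃ a b c d, G = Matrix.fromBlocks a b c d :=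
    ⟨_, _, _, _, (Matrix.fromBlocks_toBlocks G).symm⟩
  have ha : a.PosDef := by simpa using posDef_toBlocks₁₁ hG
  have hu : IsUnit a.det := isUnit_iff_ne_zero.2 ha.det_pos.ne'
  have hherm := hG.isHermitian
  rw [Matrix.IsHermitian, Matrix.conjTranspose_eq_transpose_of_trivial,
    Matrix.fromBlocks_transpose] at hherm
  obtain ⟨hat, hct, hbt, -⟩ := Matrix.fromBlocks_inj.1 hherm
  obtain ⟨h1, -, h3⟩ := SymplecticGroup.fromBlocks_mem_iff.1 hmem
  rw [hat, hct] at h1 h3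
  have hbX : a⁻¹ * b = c * a⁻¹ := by
    calc a⁻¹ * b = a⁻¹ * (b * a) * a⁻¹ := by
          rw [mul_assoc, mul_assoc, Matrix.mul_nonsing_inv _ hu, mul_one]
      _ = c * a⁻¹ := by rw [← h1, ← mul_assoc, Matrix.nonsing_inv_mul _ hu, one_mul]
  have hd : d = a⁻¹ * b * b + a⁻¹ := by
    calc d = a⁻¹ * (a * d) := by rw [← mul_assoc, Matrix.nonsing_inv_mul _ hu, one_mul]
      _ = a⁻¹ * (b * b + 1) := by rw [← h3]; congr 1; abel
      _ = _ := by rw [mul_add, mul_one, mul_assoc]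
  refine ⟨a⁻¹, -(a⁻¹ * b), ha.inv, ?_, ?_⟩
  · rw [Matrix.IsSymm, Matrix.transpose_neg, Matrix.transpose_mul, Matrix.transpose_nonsing_inv,
      hat, hbt, hbX]
  · rw [gaussianGram, Matrix.nonsing_inv_nonsing_inv _ hu, Matrix.fromBlocks_inj]
    refine ⟨rfl, ?_, ?_, ?_⟩
    · rw [mul_neg, neg_neg, ← mul_assoc, Matrix.mul_nonsing_inv _ hu, one_mul]
    · rw [neg_mul, neg_neg, hbX, mul_assoc, Matrix.nonsing_inv_mul _ hu, mul_one]
    · rw [neg_mul, neg_mul_neg, hd, mul_assoc _ a, ← mul_assoc a, Matrix.mul_nonsing_inv _ hu,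
        one_mul]

/-! ### Quantum blobs and covariance ellipsoids -/

/-- The quadratic form `z ↦ |S⁻¹z|²`. -/
def blobForm {n : ℕ} (S : Matrix.symplecticGroup (Fin n) ℝ) (z : PhaseSpace n) : ℝ :=
  ‖(sympEquiv S).symm z‖ ^ 2

lemma blobForm_eq_inner {n : ℕ} (S : Matrix.symplecticGroup (Fin n) ℝ) (z : PhaseSpace n) :
    blobForm S z = inner ℝ (Matrix.toEuclideanLin (S.1 * S.1.transpose)⁻¹ z) z := by
  rw [Matrix.mul_inv_rev, ← Matrix.transpose_nonsing_inv, toEuclideanLin_mul_apply,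
    inner_toEuclideanLin, Matrix.transpose_transpose, ← SymplecticGroup.coe_inv',
    ← sympEquiv_symm_apply, real_inner_self_eq_norm_sq, blobForm]

lemma quantumBlob_eq {n : ℕ} {hbar : ℝ} (hpos : 0 < hbar)
    (S : Matrix.symplecticGroup (Fin n) ℝ) :
    quantumBlob hbar S = {z | (1 / hbar) * blobForm S z ≤ 1} := by
  have key : ∀ w : PhaseSpace n, ‖w‖ ≤ Real.sqrt hbar ↔ (1 / hbar) * ‖w‖ ^ 2 ≤ 1 := fun w => by
    rw [Real.le_sqrt (norm_nonneg _) hpos.le, one_div, inv_mul_le_iff₀ hpos, mul_one]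
  ext z
  constructor
  · rintro ⟨w, hw, rfl⟩
    rw [Set.mem_ofPred_eq, blobForm, ← sympEquiv_apply, LinearEquiv.symm_apply_apply, ← key]
    simpa using hw
  · intro hz
    rw [Set.mem_ofPred_eq, blobForm, ← key] at hz
    exact ⟨(sympEquiv S).symm z, by simpa using hz, (sympEquiv S).apply_symm_apply z⟩

/-- A nonnegative 2-homogeneous function is determined by its unit sublevel set. -/
lemma eq_of_unit_sublevel_eq {V : Type*} [AddCommGroup V] [Module ℝ V] {f g : V → ℝ}
    (hf : ∀ (r : ℝ) v, f (r • v) = r ^ 2 * f v) (hg : ∀ (r : ℝ) v, g (r • v) = r ^ 2 * g v)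
    (hf0 : ∀ v, 0 ≤ f v) (hg0 : ∀ v, 0 ≤ g v) (h : {v | f v ≤ 1} = {v | g v ≤ 1}) : f = g := by
  have key : ∀ {f g : V → ℝ}, (∀ (r : ℝ) v, f (r • v) = r ^ 2 * f v) →
      (∀ (r : ℝ) v, g (r • v) = r ^ 2 * g v) → (∀ v, 0 ≤ f v) →
      {v | f v ≤ 1} = {v | g v ≤ 1} → ∀ v, g v ≤ f v := by
    intro f g hf hg hf0 h v
    by_contra! hlt
    -- If `f v < s < g v`, the point `v/√s` lies in the unit sublevel set of `f` but not in that of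
    -- `g`.
    obtain ⟨s, hs1, hs2⟩ := exists_between hlt
    have hs : 0 < s := (hf0 v).trans_lt hs1
    have hr : (Real.sqrt s)⁻¹ ^ 2 = s⁻¹ := by rw [inv_pow, Real.sq_sqrt hs.le]
    have h1 : (Real.sqrt s)⁻¹ • v ∈ {v | f v ≤ 1} := by
      rw [Set.mem_ofPred_eq, hf, hr, inv_mul_le_iff₀ hs]
      linarith
    rw [h, Set.mem_ofPred_eq, hg, hr, inv_mul_le_iff₀ hs] at h1
    linarith
  ext v
  exact le_antisymm (key hg hf hg0 h.symm v) (key hf hg hf0 h v)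

lemma inner_toEuclideanLin_smul {ι : Type*} [Fintype ι] [DecidableEq ι] (A : Matrix ι ι ℝ)
    (r : ℝ) (v : EuclideanSpace ℝ ι) :
    inner ℝ (Matrix.toEuclideanLin A (r • v)) (r • v) =
      r ^ 2 * inner ℝ (Matrix.toEuclideanLin A v) v := by
  rw [map_smul, real_inner_smul_left, real_inner_smul_right]
  ring

lemma inner_toEuclideanLin_nonneg {ι : Type*} [Fintype ι] [DecidableEq ι] {A : Matrix ι ι ℝ}
    (hA : A.PosDef) (v : EuclideanSpace ℝ ι) : 0 ≤ inner ℝ (Matrix.toEuclideanLin A v) v := by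
  have := hA.posSemidef.dotProduct_mulVec_nonneg v
  simpa [PiLp.inner_apply, Matrix.toLpLin_apply, dotProduct, mul_comm] using this

lemma matrix_eq_of_quadratic_eq {ι : Type*} [Fintype ι] [DecidableEq ι] {A B : Matrix ι ι ℝ}
    (hA : A.IsSymm) (hB : B.IsSymm)
    (h : ∀ v : EuclideanSpace ℝ ι, inner ℝ (Matrix.toEuclideanLin A v) v =
      inner ℝ (Matrix.toEuclideanLin B v) v) : A = B := by
  apply matrix_eq_of_inner_eq
  intro x y
  have h1 := h (x + y)
  simp only [map_add, inner_add_left, inner_add_right, h x, h y] at h1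
  have hA' : inner ℝ (Matrix.toEuclideanLin A x) y = inner ℝ x (Matrix.toEuclideanLin A y) := by
    rw [inner_toEuclideanLin, hA.eq]
  have hB' : inner ℝ (Matrix.toEuclideanLin B x) y = inner ℝ x (Matrix.toEuclideanLin B y) := by
    rw [inner_toEuclideanLin, hB.eq]
  rw [real_inner_comm x (Matrix.toEuclideanLin A y), real_inner_comm x (Matrix.toEuclideanLin B y),
    hA', hB'] at h1
  linarith

lemma blobForm_smul {n : ℕ} (S : Matrix.symplecticGroup (Fin n) ℝ) (r : ℝ) (z : PhaseSpace n) :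
    blobForm S (r • z) = r ^ 2 * blobForm S z := by
  rw [blobForm, map_smul, norm_smul, mul_pow, Real.norm_eq_abs, sq_abs, blobForm]

lemma blobForm_eq_of_quantumBlob_eq {n : ℕ} {hbar : ℝ} (hpos : 0 < hbar)
    {S R : Matrix.symplecticGroup (Fin n) ℝ} (h : quantumBlob hbar S = quantumBlob hbar R) :
    blobForm S = blobForm R := by
  rw [quantumBlob_eq hpos, quantumBlob_eq hpos] at h
  have h0 : ∀ (S : Matrix.symplecticGroup (Fin n) ℝ) z, 0 ≤ (1 / hbar) * blobForm S z :=
    fun S z => by unfold blobForm; positivity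
  have := eq_of_unit_sublevel_eq (fun r v => by rw [blobForm_smul]; ring)
    (fun r v => by rw [blobForm_smul]; ring) (h0 S) (h0 R) h
  ext z
  exact mul_left_cancel₀ (one_div_ne_zero hpos.ne') (congrFun this z)

/-- The blob form is the quadratic form of the symmetric matrix `(SSᵀ)⁻¹`; a symmetric matrix is
recovered from its form by polarization. -/
lemma mul_transpose_eq_iff_blobForm_eq {n : ℕ} {S R : Matrix.symplecticGroup (Fin n) ℝ} :
    S.1 * S.1.transpose = R.1 * R.1.transpose ↔ blobForm S = blobForm R := by
  constructor
  · intro h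
    ext z
    rw [blobForm_eq_inner, blobForm_eq_inner, h]
  · intro h
    have hu : ∀ S : Matrix.symplecticGroup (Fin n) ℝ, IsUnit (S.1 * S.1.transpose).det :=
      fun S => isUnit_iff_ne_zero.2 (posDef_mul_transpose S).det_pos.ne'
    have hs : ∀ S : Matrix.symplecticGroup (Fin n) ℝ, ((S.1 * S.1.transpose)⁻¹).IsSymm :=
      fun S => by
        rw [Matrix.IsSymm, Matrix.transpose_nonsing_inv, Matrix.transpose_mul,
          Matrix.transpose_transpose]
    have h1 := matrix_eq_of_quadratic_eq (hs S) (hs R) fun z => by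
      rw [← blobForm_eq_inner, ← blobForm_eq_inner, h]
    rw [← Matrix.nonsing_inv_nonsing_inv _ (hu S), h1, Matrix.nonsing_inv_nonsing_inv _ (hu R)]

/-- The covariance matrix of the quantum blob of `S`. -/
def blobCovariance {n : ℕ} (hbar : ℝ) (S : Matrix.symplecticGroup (Fin n) ℝ) :
    Matrix (Fin n ⊕ Fin n) (Fin n ⊕ Fin n) ℝ := (hbar / 2) • (S.1 * S.1.transpose)

lemma blobCovariance_posDef {n : ℕ} {hbar : ℝ} (hpos : 0 < hbar)
    (S : Matrix.symplecticGroup (Fin n) ℝ) : (blobCovariance hbar S).PosDef :=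
  (posDef_mul_transpose S).smul (half_pos hpos)

lemma inner_blobCovariance_inv {n : ℕ} {hbar : ℝ} (hpos : 0 < hbar)
    (S : Matrix.symplecticGroup (Fin n) ℝ) (z : PhaseSpace n) :
    inner ℝ (Matrix.toEuclideanLin (blobCovariance hbar S)⁻¹ z) z = 2 / hbar * blobForm S z := by
  have hdet := isUnit_iff_ne_zero.2 (posDef_mul_transpose S).det_pos.ne'
  have : (blobCovariance hbar S)⁻¹ = (hbar / 2)⁻¹ • (S.1 * S.1.transpose)⁻¹ :=
    Matrix.inv_smul' _ (Units.mk0 _ (half_pos hpos).ne') hdet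
  rw [this, map_smul, LinearMap.smul_apply, real_inner_smul_left, ← blobForm_eq_inner, inv_div]

lemma covarianceEllipsoid_blobCovariance {n : ℕ} {hbar : ℝ} (hpos : 0 < hbar)
    (S : Matrix.symplecticGroup (Fin n) ℝ) :
    covarianceEllipsoid (blobCovariance hbar S) = quantumBlob hbar S := by
  rw [quantumBlob_eq hpos, covarianceEllipsoid]
  ext z
  rw [Set.mem_ofPred_eq, Set.mem_ofPred_eq, inner_blobCovariance_inv hpos]
  ring_nf

/-- By homogeneity the ellipsoid determines the form `½Σ⁻¹z·z`, so the definition of a Gaussian pure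
state leaves no freedom in `Σ`. -/
lemma eq_blobCovariance {n : ℕ} {hbar : ℝ} (hpos : 0 < hbar)
    {S : Matrix.symplecticGroup (Fin n) ℝ} {Sig : Matrix (Fin n ⊕ Fin n) (Fin n ⊕ Fin n) ℝ}
    (hSig : Sig.PosDef) (h : covarianceEllipsoid Sig = quantumBlob hbar S) :
    Sig = blobCovariance hbar S := by
  rw [← covarianceEllipsoid_blobCovariance hpos] at h
  have hpd := blobCovariance_posDef hpos S
  have hom : ∀ (A : Matrix (Fin n ⊕ Fin n) (Fin n ⊕ Fin n) ℝ) (r : ℝ) (v : PhaseSpace n),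
      1 / 2 * inner ℝ (Matrix.toEuclideanLin A (r • v)) (r • v) =
        r ^ 2 * (1 / 2 * inner ℝ (Matrix.toEuclideanLin A v) v) := fun A r v => by
    rw [inner_toEuclideanLin_smul]; ring
  have nn : ∀ {A : Matrix (Fin n ⊕ Fin n) (Fin n ⊕ Fin n) ℝ}, A.PosDef → ∀ v : PhaseSpace n,
      0 ≤ 1 / 2 * inner ℝ (Matrix.toEuclideanLin A v) v := fun hA v =>
    mul_nonneg (by norm_num) (inner_toEuclideanLin_nonneg hA v)
  have h1 := eq_of_unit_sublevel_eq (hom Sig⁻¹) (hom _) (nn hSig.inv) (nn hpd.inv) h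
  have hsym : ∀ {A : Matrix (Fin n ⊕ Fin n) (Fin n ⊕ Fin n) ℝ}, A.PosDef → A⁻¹.IsSymm :=
    fun hA => by
      have := hA.inv.isHermitian
      rwa [Matrix.IsHermitian, Matrix.conjTranspose_eq_transpose_of_trivial] at this
  have h2 := matrix_eq_of_quadratic_eq (hsym hSig) (hsym hpd) fun z =>
    mul_left_cancel₀ (by norm_num : (1 / 2 : ℝ) ≠ 0) (congrFun h1 z)
  rw [← Matrix.nonsing_inv_nonsing_inv _ (isUnit_iff_ne_zero.2 hSig.det_pos.ne'), h2,
    Matrix.nonsing_inv_nonsing_inv _ (isUnit_iff_ne_zero.2 hpd.det_pos.ne')]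

lemma gaussianDensity_blobCovariance {n : ℕ} {hbar : ℝ} (hpos : 0 < hbar)
    (S : Matrix.symplecticGroup (Fin n) ℝ) (z : PhaseSpace n) :
    gaussianDensity (blobCovariance hbar S) z =
      (1 / (Real.pi * hbar)) ^ n * Real.exp (-(1 / hbar) * blobForm S z) := by
  have hdet : Real.sqrt (blobCovariance hbar S).det = (hbar / 2) ^ n := by
    rw [blobCovariance, Matrix.det_smul, Matrix.det_mul, Matrix.det_transpose,
      SymplecticGroup.det_eq_one S.2, mul_one, mul_one, Fintype.card_sum, Fintype.card_fin, pow_add,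
      Real.sqrt_mul_self (by positivity)]
  have h2 : 2 * Real.pi * (hbar / 2) = Real.pi * hbar := by ring
  rw [gaussianDensity, hdet, inner_blobCovariance_inv hpos, ← mul_pow, one_div_pow, h2]
  congr 2
  ring

/-! ### The Wigner transform of Gaussians -/

lemma wignerTransform_congr {n : ℕ} (hbar : ℝ) {f g : EuclideanSpace ℝ (Fin n) → ℂ}
    (h : f =ᵐ[volume] g) (z : PhaseSpace n) : wignerTransform hbar f z = wignerTransform hbar g z := by
  have hq : Measure.QuasiMeasurePreserving
      (fun y : EuclideanSpace ℝ (Fin n) => (1 / 2 : ℝ) • y) volume volume :=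
    Measure.quasiMeasurePreserving_smul volume (by norm_num)
  have h1 := ((measurePreserving_add_left volume (posPart z)).quasiMeasurePreserving.comp hq).ae h
  have h2 := ((Measure.measurePreserving_sub_left volume
    (posPart z)).quasiMeasurePreserving.comp hq).ae h
  unfold wignerTransform
  congr 1
  apply integral_congr_ae
  filter_upwards [h1, h2] with y hy1 hy2
  rw [Function.comp_apply] at hy1 hy2
  rw [hy1, hy2]

theorem wignerTransform_standardGaussian {n : ℕ} {hbar : ℝ} (hpos : 0 < hbar) (z : PhaseSpace n) :
    wignerTransform hbar (standardGaussian n hbar hpos) z =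
      (((1 / (Real.pi * hbar)) ^ n * Real.exp (-(1 / hbar) * ‖z‖ ^ 2) : ℝ) : ℂ) := by
  rw [standardGaussian, wignerTransform_congr hbar (memLp_standardGaussianFun n hpos).coeFn_toLp,
    wignerTransform]
  have hne : (hbar : ℂ) ≠ 0 := by exact_mod_cast hpos.ne'
  have hpi : (Real.pi : ℂ) ≠ 0 := by exact_mod_cast Real.pi_ne_zero
  set K : ℝ := (Real.pi * hbar) ^ (-(n : ℝ) / 4) with hK
  -- The squared normalization of `φ₀` times the Gaussian integral `(4πħ)^{n/2}` leaves `2ⁿ`, which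
  -- turns the prefactor `(2πħ)⁻ⁿ` into `(πħ)⁻ⁿ`.
  have hK4 : K * K * (4 * Real.pi * hbar) ^ ((n : ℝ) / 2) = 2 ^ n := by
    have hph : 0 < Real.pi * hbar := by positivity
    rw [hK, ← Real.rpow_add hph, mul_assoc 4, Real.mul_rpow (by norm_num) hph.le,
      mul_left_comm, ← Real.rpow_add hph]
    have e1 : -(n : ℝ) / 4 + -(n : ℝ) / 4 + (n : ℝ) / 2 = 0 := by ring
    have e2 : (4 : ℝ) = 2 ^ (2 : ℝ) := by norm_num
    rw [e1, Real.rpow_zero, mul_one, e2, ← Real.rpow_mul (by norm_num), ← Real.rpow_natCast]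
    congr 1
    ring
  have hint : ∀ y : EuclideanSpace ℝ (Fin n),
      Complex.exp (-(Complex.I / (hbar : ℂ)) * ((inner ℝ (momPart z) y : ℝ) : ℂ)) *
        (standardGaussianFun n hbar (posPart z + (1 / 2 : ℝ) • y) *
          (starRingEnd ℂ) (standardGaussianFun n hbar (posPart z - (1 / 2 : ℝ) • y))) =
      ((K * K * Real.exp (-(1 / hbar) * ‖posPart z‖ ^ 2) : ℝ) : ℂ) *
        Complex.exp (-((1 / (4 * hbar) : ℝ) : ℂ) * (‖y‖ : ℂ) ^ 2 +
          -(Complex.I / (hbar : ℂ)) * ((inner ℝ (momPart z) y : ℝ) : ℂ)) := by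
    intro y
    simp only [standardGaussianFun, Complex.conj_ofReal, ← hK]
    -- The parallelogram law removes the cross term `x·y` and separates the two Gaussians.
    have hpl : ‖posPart z + (1 / 2 : ℝ) • y‖ ^ 2 + ‖posPart z - (1 / 2 : ℝ) • y‖ ^ 2 =
        2 * ‖posPart z‖ ^ 2 + 1 / 2 * ‖y‖ ^ 2 := by
      have := parallelogram_law_with_norm ℝ (posPart z) ((1 / 2 : ℝ) • y)
      rw [norm_smul, Real.norm_of_nonneg (by norm_num)] at this
      nlinarith
    rw [Complex.exp_add]
    have hreal : K * Real.exp (-‖posPart z + (1 / 2 : ℝ) • y‖ ^ 2 / (2 * hbar)) *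
        (K * Real.exp (-‖posPart z - (1 / 2 : ℝ) • y‖ ^ 2 / (2 * hbar))) =
        K * K * Real.exp (-(1 / hbar) * ‖posPart z‖ ^ 2) *
          Real.exp (-(1 / (4 * hbar)) * ‖y‖ ^ 2) := by
      rw [mul_mul_mul_comm, ← Real.exp_add, mul_assoc (K * K), ← Real.exp_add]
      congr 2
      rw [← add_div, ← neg_add, hpl]
      field_simp
      ring
    rw [← Complex.ofReal_mul, hreal]
    push_cast
    ring
  rw [integral_congr_ae (Filter.Eventually.of_forall hint), integral_const_mul,
    GaussianFourier.integral_cexp_neg_mul_sq_norm_add (by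
      rw [Complex.ofReal_re]; positivity), finrank_euclideanSpace_fin]
  have hpow : ((Real.pi : ℂ) / ((1 / (4 * hbar) : ℝ) : ℂ)) ^ ((n : ℂ) / 2) =
      (((4 * Real.pi * hbar) ^ ((n : ℝ) / 2) : ℝ) : ℂ) := by
    rw [Complex.ofReal_cpow (by positivity)]
    congr 1
    · push_cast; field_simp
    · push_cast; rfl
  have hexp : Complex.exp ((-(Complex.I / (hbar : ℂ))) ^ 2 * (‖momPart z‖ : ℂ) ^ 2 /
      (4 * ((1 / (4 * hbar) : ℝ) : ℂ))) =
      ((Real.exp (-(1 / hbar) * ‖momPart z‖ ^ 2) : ℝ) : ℂ) := by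
    rw [Complex.ofReal_exp]
    congr 1
    rw [neg_sq, div_pow, Complex.I_sq]
    push_cast
    field_simp
  have hconst : (1 / (2 * (Real.pi : ℂ) * (hbar : ℂ))) ^ n =
      (((1 / (2 * Real.pi * hbar)) ^ n : ℝ) : ℂ) := by push_cast; rfl
  rw [hpow, hexp, hconst]
  norm_cast
  rw [norm_sq_eq_parts z, mul_add, Real.exp_add]
  have : (1 / (2 * Real.pi * hbar)) ^ n * (2 : ℝ) ^ n = (1 / (Real.pi * hbar)) ^ n := by
    rw [← mul_pow]; congr 1; field_simp
  rw [← this, ← hK4]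
  ring

theorem wignerTransform_metaplectic_standardGaussian {n : ℕ} {hbar : ℝ} (hpos : 0 < hbar)
    {U : L2Space n ≃ₗᵢ[ℂ] L2Space n} {S : Matrix.symplecticGroup (Fin n) ℝ}
    (h : MetaplecticCovers hbar U S) (z : PhaseSpace n) :
    wignerTransform hbar (U (standardGaussian n hbar hpos)) z =
      ((gaussianDensity (blobCovariance hbar S) z : ℝ) : ℂ) := by
  have h1 := wignerTransform_metaplectic hpos h (standardGaussian n hbar hpos)
    ((sympEquiv S).symm z)
  rw [LinearEquiv.apply_symm_apply] at h1
  rw [h1, wignerTransform_standardGaussian, gaussianDensity_blobCovariance hpos, blobForm]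

/-! ### Gaussian pure states of a quantum blob -/

lemma gaussianDensity_ne_zero {n : ℕ} {Sig : Matrix (Fin n ⊕ Fin n) (Fin n ⊕ Fin n) ℝ}
    (hSig : Sig.PosDef) (z : PhaseSpace n) : gaussianDensity Sig z ≠ 0 := by
  have := Real.sqrt_pos.2 hSig.det_pos
  unfold gaussianDensity
  positivity

/-- The Gaussian pure states of the quantum blob of `S` are the states `c Ŝφ₀`, `|c| = 1`. -/
theorem isGaussianPureStateOf_quantumBlob_iff {n : ℕ} {hbar : ℝ} (hpos : 0 < hbar)
    {U : L2Space n ≃ₗᵢ[ℂ] L2Space n} {S : Matrix.symplecticGroup (Fin n) ℝ}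
    (h : MetaplecticCovers hbar U S) (ψ : L2Space n) :
    IsGaussianPureStateOf hbar ψ (quantumBlob hbar S) ↔
      ∃ c : ℂ, ‖c‖ = 1 ∧ ψ = c • U (standardGaussian n hbar hpos) := by
  have hW := wignerTransform_metaplectic_standardGaussian hpos h
  have hpd := blobCovariance_posDef hpos S
  constructor
  · rintro ⟨Sig, hSig, hψ, hΩ⟩
    rw [eq_blobCovariance hpos hSig hΩ] at hψ
    refine eq_phase_smul_of_wignerTransform_eq hpos ?_ fun z => by rw [hψ, hW]
    intro h0
    have h1 := hW 0
    rw [h0, wignerTransform_eq_inner hpos, inner_zero_left, mul_zero, eq_comm] at h1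
    exact gaussianDensity_ne_zero hpd 0 (by exact_mod_cast h1)
  · rintro ⟨c, hc, rfl⟩
    exact ⟨_, hpd, fun z => by rw [wignerTransform_phase_smul hpos hc, hW],
      covarianceEllipsoid_blobCovariance hpos S⟩

/-- A Gaussian pure state corresponds to at most one set. -/
theorem IsGaussianPureStateOf.unique {n : ℕ} {hbar : ℝ} {ψ : L2Space n} {Ω Ω' : Set (PhaseSpace n)}
    (h : IsGaussianPureStateOf hbar ψ Ω) (h' : IsGaussianPureStateOf hbar ψ Ω') : Ω = Ω' := by
  obtain ⟨A, hA, hψA, rfl⟩ := h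
  obtain ⟨B, hB, hψB, rfl⟩ := h'
  have hAB : ∀ z, gaussianDensity A z = gaussianDensity B z := fun z => by
    exact_mod_cast (hψA z).symm.trans (hψB z)
  -- Evaluation at the origin equates the normalizing constants, so that only the exponents remain
  -- to compare.
  have h0 := hAB 0
  simp only [gaussianDensity, map_zero, inner_zero_left, mul_zero, Real.exp_zero, mul_one] at h0
  have hne : 1 / ((2 * Real.pi) ^ n * Real.sqrt B.det) ≠ 0 := by
    have := Real.sqrt_pos.2 hB.det_pos
    positivity
  have hq : ∀ z : PhaseSpace n, inner ℝ (Matrix.toEuclideanLin A⁻¹ z) z =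
      inner ℝ (Matrix.toEuclideanLin B⁻¹ z) z := fun z => by
    have h1 := hAB z
    rw [gaussianDensity, gaussianDensity, h0] at h1
    have h2 := Real.exp_injective (mul_left_cancel₀ hne h1)
    linarith
  unfold covarianceEllipsoid
  simp only [hq]

open scoped ComplexOrder MatrixOrder in
lemma exists_transpose_mul_self_eq {n : ℕ} {X : Matrix (Fin n) (Fin n) ℝ} (hX : X.PosDef) :
    ∃ L : Matrix (Fin n) (Fin n) ℝ, L.transpose * L = X := by
  obtain ⟨L, hL⟩ := CStarAlgebra.nonneg_iff_eq_star_mul_self.1 hX.posSemidef.nonneg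
  refine ⟨L, ?_⟩
  rw [hL, Matrix.star_eq_conjTranspose, Matrix.conjTranspose_eq_transpose_of_trivial]

lemma generalizedGaussian_add_phase {n : ℕ} (hbar : ℝ) (X Y : Matrix (Fin n) (Fin n) ℝ)
    (γ μ : ℝ) (x : EuclideanSpace ℝ (Fin n)) :
    generalizedGaussian hbar X Y (μ + γ) x =
      Complex.I ^ (μ : ℂ) * generalizedGaussian hbar X Y γ x := by
  rw [generalizedGaussian, generalizedGaussian, Complex.ofReal_add,
    Complex.cpow_add _ _ Complex.I_ne_zero]
  ring

/-- Generalized Gaussians are metaplectic images of the standard Gaussian. -/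
theorem exists_covers_generalizedGaussian {n : ℕ} {hbar : ℝ} (hpos : 0 < hbar)
    {X Y : Matrix (Fin n) (Fin n) ℝ} (hX : X.PosDef) (hY : Y.IsSymm) :
    ∃ (U : L2Space n ≃ₗᵢ[ℂ] L2Space n) (S : Matrix.symplecticGroup (Fin n) ℝ) (γ : ℝ),
      MetaplecticCovers hbar U S ∧ S.1 * S.1.transpose = gaussianGram X Y ∧
      (U (standardGaussian n hbar hpos) : EuclideanSpace ℝ (Fin n) → ℂ) =ᵐ[volume]
        generalizedGaussian hbar X Y γ := by
  -- With `LᵀL = X` the rescaling by `L` turns `|x|²` into `Xx·x` and `√|det L|` is `(det X)^{1/4}`;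
  -- the chirp with `P = -Y` supplies the remaining phase.
  obtain ⟨L, hLX⟩ := exists_transpose_mul_self_eq hX
  have hdetX : X.det = L.det ^ 2 := by rw [← hLX, Matrix.det_mul, Matrix.det_transpose, sq]
  have hL : L.det ≠ 0 := fun h0 => hX.det_pos.ne' (by rw [hdetX, h0]; norm_num)
  have hY' : (-Y).IsSymm := hY.neg
  obtain ⟨V, hV, hVact⟩ := exists_isChirpPair hbar hY' (S := ⟨_, lower_mem_symplecticGroup hY'⟩) rfl
  obtain ⟨R, hR, m, hRact⟩ := exists_isRescalingPair hL (S := ⟨_, diag_mem_symplecticGroup hL⟩) rfl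
  refine ⟨V * R, _, m, covers_mul hV.covers (hR.covers hbar), ?_, ?_⟩
  · have hinv : L⁻¹ * L.transpose⁻¹ = X⁻¹ := by rw [← hLX, Matrix.mul_inv_rev]
    simp only [Submonoid.coe_mul, Matrix.fromBlocks_multiply, Matrix.fromBlocks_transpose,
      gaussianGram]
    simp only [one_mul, zero_mul, mul_zero, add_zero, zero_add, Matrix.transpose_zero,
      Matrix.transpose_mul, Matrix.transpose_neg, hY.eq, neg_mul, mul_neg, neg_neg,
      Matrix.transpose_nonsing_inv]
    rw [hinv, ← mul_assoc L⁻¹, hinv, mul_assoc Y, hinv, Matrix.transpose_transpose, hLX,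
      mul_assoc Y, ← mul_assoc L⁻¹, hinv, ← mul_assoc]
  · have hact := hVact.mul hRact (Measure.QuasiMeasurePreserving.id _)
    refine (hact _).trans ?_
    have hq := quasiMeasurePreserving_toEuclideanLin hL
    filter_upwards [hq.ae (memLp_standardGaussianFun n hpos).coeFn_toLp] with x hx
    simp only [id]
    rw [standardGaussian, hx, standardGaussianFun, generalizedGaussian]
    have hI : Complex.I ^ ((m : ℝ) : ℂ) = Complex.I ^ m := by
      rw [Complex.ofReal_intCast, Complex.cpow_intCast]
    have hquarter : X.det ^ ((1 : ℝ) / 4) = Real.sqrt |L.det| := by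
      rw [hdetX, ← sq_abs, Real.sqrt_eq_rpow, ← Real.rpow_natCast, ← Real.rpow_mul (abs_nonneg _)]
      norm_num
    have hK : (1 / (Real.pi * hbar)) ^ ((n : ℝ) / 4) = (Real.pi * hbar) ^ (-(n : ℝ) / 4) := by
      rw [one_div, Real.inv_rpow (by positivity), ← Real.rpow_neg (by positivity), neg_div]
    have hn : ‖Matrix.toEuclideanLin L x‖ ^ 2 = inner ℝ (Matrix.toEuclideanLin X x) x := by
      rw [← real_inner_self_eq_norm_sq, inner_toEuclideanLin, ← toEuclideanLin_mul_apply, hLX,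
        real_inner_comm]
    have hneg : inner ℝ (Matrix.toEuclideanLin (-Y) x) x =
        -inner ℝ (Matrix.toEuclideanLin Y x) x := by
      rw [map_neg, LinearMap.neg_apply, inner_neg_left]
    rw [hI, hquarter, hK, hn, hneg, mul_add, Complex.exp_add]
    have e1 : Complex.exp (Complex.I / (2 * (hbar : ℂ)) *
        ((-inner ℝ (Matrix.toEuclideanLin Y x) x : ℝ) : ℂ)) =
        Complex.exp (-(1 / (2 * (hbar : ℂ))) *
          (Complex.I * ((inner ℝ (Matrix.toEuclideanLin Y x) x : ℝ) : ℂ))) := by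
      congr 1; push_cast; ring
    have e2 : ((Real.exp (-inner ℝ (Matrix.toEuclideanLin X x) x / (2 * hbar)) : ℝ) : ℂ) =
        Complex.exp (-(1 / (2 * (hbar : ℂ))) *
          ((inner ℝ (Matrix.toEuclideanLin X x) x : ℝ) : ℂ)) := by
      rw [Complex.ofReal_exp]; congr 1; push_cast; ring
    rw [e1, Complex.ofReal_mul, e2, Complex.ofReal_mul]
    ring

/-- One metaplectic image of `φ₀` is a `ψ_{X,Y}` with some phase `γ₀`. Multiplication by unimodular
constants sweeps out all `γ`, and these are all the states of the blob. -/
theorem isGaussianPureStateOf_iff_generalizedGaussian {n : ℕ} {hbar : ℝ} (hpos : 0 < hbar)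
    {X Y : Matrix (Fin n) (Fin n) ℝ} (hX : X.PosDef) (hY : Y.IsSymm) :
    ∃ R : Matrix.symplecticGroup (Fin n) ℝ, R.1 * R.1.transpose = gaussianGram X Y ∧
      ∀ ψ : L2Space n, IsGaussianPureStateOf hbar ψ (quantumBlob hbar R) ↔
        ∃ γ : ℝ, (ψ : EuclideanSpace ℝ (Fin n) → ℂ) =ᵐ[volume] generalizedGaussian hbar X Y γ := by
  obtain ⟨U, R, γ₀, hU, hR, hφ⟩ := exists_covers_generalizedGaussian hpos hX hY
  refine ⟨R, hR, fun ψ => ?_⟩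
  rw [isGaussianPureStateOf_quantumBlob_iff hpos hU]
  have hsmul : ∀ μ : ℝ, ((Complex.I ^ (μ : ℂ) • U (standardGaussian n hbar hpos) : L2Space n) :
      EuclideanSpace ℝ (Fin n) → ℂ) =ᵐ[volume] generalizedGaussian hbar X Y (μ + γ₀) := fun μ => by
    filter_upwards [hφ, Lp.coeFn_smul (Complex.I ^ (μ : ℂ)) (U (standardGaussian n hbar hpos))]
      with x hx hx'
    rw [hx', Pi.smul_apply, hx, smul_eq_mul, generalizedGaussian_add_phase]
  constructor
  · rintro ⟨c, hc, rfl⟩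
    obtain ⟨μ, rfl⟩ := exists_I_cpow_eq hc
    exact ⟨μ + γ₀, hsmul μ⟩
  · rintro ⟨γ, hγ⟩
    refine ⟨_, norm_I_cpow_ofReal (γ - γ₀), Lp.ext (hγ.trans ?_)⟩
    have := hsmul (γ - γ₀)
    rw [sub_add_cancel] at this
    exact this.symm

end

/-! ### Assembly of the theorem -/

theorem mainTheorem2 (n : ℕ) (hbar : ℝ) (hpos : 0 < hbar)
    (ℓ ℓ' : Submodule ℝ (PhaseSpace n)) (hframe : IsLagrangianFrame ℓ ℓ')
    (Xℓ : Set (PhaseSpace n)) (hXℓ : IsCenteredEllipsoidOn ℓ Xℓ) :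
    IsCenteredEllipsoidOn ℓ' (lagrangianPolarDual hbar ℓ' Xℓ) ∧
    ∃ Ω : Set (PhaseSpace n),
      (IsJohnEllipsoid (frameProduct Xℓ (lagrangianPolarDual hbar ℓ' Xℓ)) Ω ∧
        ∀ Ω' : Set (PhaseSpace n),
          IsJohnEllipsoid (frameProduct Xℓ (lagrangianPolarDual hbar ℓ' Xℓ)) Ω' → Ω' = Ω) ∧
      (∃ S : Matrix.symplecticGroup (Fin n) ℝ, Ω = quantumBlob hbar S) ∧
      (∀ S : Matrix.symplecticGroup (Fin n) ℝ, Ω = quantumBlob hbar S →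
        (∃ Shat ∈ metaplecticGroup n hbar, MetaplecticCovers hbar Shat S) ∧
        ∀ Shat ∈ metaplecticGroup n hbar, MetaplecticCovers hbar Shat S →
          ∀ ψ : L2Space n, IsGaussianPureStateOf hbar ψ Ω ↔
            ∃ μ : ℝ, ψ = (Complex.I ^ (μ : ℂ)) • Shat (standardGaussian n hbar hpos) ∨
              ψ = -((Complex.I ^ (μ : ℂ)) • Shat (standardGaussian n hbar hpos))) ∧
      (∃! XY : Matrix (Fin n) (Fin n) ℝ × Matrix (Fin n) (Fin n) ℝ,
        XY.1.PosDef ∧ XY.2.IsSymm ∧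
        ∀ ψ : L2Space n, IsGaussianPureStateOf hbar ψ Ω ↔
          ∃ γ : ℝ, (ψ : EuclideanSpace ℝ (Fin n) → ℂ) =ᵐ[volume]
            generalizedGaussian hbar XY.1 XY.2 γ) := by
  have hs : 0 < Real.sqrt hbar := Real.sqrt_pos.2 hpos
  obtain ⟨T₁, T₂, hT₁, hT₂, rfl, hpair⟩ := exists_frame_param hs hframe hXℓ
  rw [lagrangianPolarDual_param hpos hT₂ hpair]
  refine ⟨⟨Real.sqrt hbar • T₂, ?_, (image_closedBall_smul _ hs).symm⟩, ?_⟩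
  · rw [LinearMap.range_smul _ _ hs.ne', hT₂]
  obtain ⟨S₀, hS₀⟩ := exists_symplectic_frame hframe hT₁ hT₂ hpair
  rw [frameProduct_param hS₀]
  obtain ⟨hJ, hJu⟩ := johnEllipsoid_ballProduct hs (sympEquiv S₀)
  refine ⟨quantumBlob hbar S₀, ⟨hJ, hJu⟩, ⟨S₀, rfl⟩, fun S hS => ⟨?_, fun U _ hU ψ => ?_⟩, ?_⟩
  · obtain ⟨U, hU⟩ := exists_metaplecticCovers hpos S
    exact ⟨U, ⟨(U, S), hU, rfl⟩, hU⟩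
  · rw [hS, isGaussianPureStateOf_quantumBlob_iff hpos hU]
    constructor
    · rintro ⟨c, hc, rfl⟩
      obtain ⟨μ, rfl⟩ := exists_I_cpow_eq hc
      exact ⟨μ, Or.inl rfl⟩
    · rintro ⟨μ, h | h⟩
      · exact ⟨_, norm_I_cpow_ofReal μ, h⟩
      -- The sign is redundant, being itself a unimodular factor.
      · exact ⟨-Complex.I ^ (μ : ℂ), by rw [norm_neg, norm_I_cpow_ofReal], by rw [h, neg_smul]⟩
  · obtain ⟨X, Y, hX, hY, hXY⟩ := exists_gaussianGram_eq S₀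
    obtain ⟨R, hR, hRψ⟩ := isGaussianPureStateOf_iff_generalizedGaussian hpos hX hY
    have hblob : quantumBlob hbar S₀ = quantumBlob hbar R := by
      rw [quantumBlob_eq hpos, quantumBlob_eq hpos,
        mul_transpose_eq_iff_blobForm_eq.1 (hXY.symm.trans hR.symm)]
    refine ⟨(X, Y), ⟨hX, hY, by rw [hblob]; exact hRψ⟩, ?_⟩
    rintro ⟨X', Y'⟩ ⟨hX', hY', h'⟩
    obtain ⟨R', hR', hRψ'⟩ := isGaussianPureStateOf_iff_generalizedGaussian hpos hX' hY'
    -- Uniqueness: a state of the blob of `R'` is a Gaussian with parameters `(X', Y')`, hence also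
    -- a state of `Ω`. A state determines its ellipsoid, so the blobs, then the Gram matrices, then
    -- the parameters agree.
    obtain ⟨U, hU⟩ := exists_metaplecticCovers hpos R'
    have hstate := (isGaussianPureStateOf_quantumBlob_iff hpos hU _).2
      ⟨1, norm_one, (one_smul ℂ (U (standardGaussian n hbar hpos))).symm⟩
    have hstate' := (h' _).2 ((hRψ' _).1 hstate)
    have hgram : gaussianGram X' Y' = gaussianGram X Y := by
      rw [← hR', hXY, mul_transpose_eq_iff_blobForm_eq]
      exact blobForm_eq_of_quantumBlob_eq hpos (hstate.unique hstate')
    obtain ⟨h1, h2⟩ := gaussianGram_injective hX' hX hgram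
    exact Prod.ext h1 h2
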